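/- Let $n\ge 2$. Let $\mathcal M_{0,n+1}$ be the moduli space of genus zero Riemann surfaces with $n+1$ distinct labelled marked points, i.e. the ordered configuration space of $n+1$ points of the Riemann sphere $\mathbb{CP}^1$ modulo the automorphism group $PGL_2(\mathbb C)$, on which $\Sigma_n$ acts by permuting the labels of the first $n$ points. Let $C_n(\mathbb C)=F_n(\mathbb C)/\Sigma_n$ be the space of unordered configurations of $n$ distinct points of $\mathbb C$, on which the circle $S^1$ acts by rotations. For a topological group $G$ and a $G$-space $X$ let $X_G=EG\times_G X$ be the homotopy quotient, where $EG$ is Milnor's universal $G$-space, and, for a commutative ring $R$ and an $R$-module $A$, let $H^G_k(X;A)=H_k(X_G;A)$ be equivariant homology (singular homology of the homotopy quotient). Then there is a homotopy equivalence $$e:(\mathcal M_{0,n+1})_{\Sigma_n}\;\xrightarrow{\ \simeq\ }\;C_n(\mathbb C)_{S^1},$$ and it induces isomorphisms of $R$-modules $H_k^{\Sigma_n}(\mathcal M_{0,n+1};A)\cong H_k^{S^1}(C_n(\mathbb C);A)$ for every $k\ge 0$, every commutative ring $R$ and every $R$-module $A$. -/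

import Mathlib

open CategoryTheory ContinuousMap
open scoped MatrixGroups

/-! ### Configuration spaces -/

/-- The ordered configuration space `F_ι(X)` of pairwise distinct points of `X` labelled by `ι`,
with the topology of a subspace of the product `ι → X`. -/
def Conf (ι X : Type) : Type := {x : ι → X // Function.Injective x}

namespace Conf

variable {ι X : Type}

instance [TopologicalSpace X] : TopologicalSpace (Conf ι X) :=
  inferInstanceAs (TopologicalSpace {x : ι → X // Function.Injective x})

/-- Relabelling: `(σ • x) i = x (σ⁻¹ i)`. -/
instance permAction : MulAction (Equiv.Perm ι) (Conf ι X) where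
  smul σ x := ⟨fun i => x.1 (σ⁻¹ i), x.2.comp (σ⁻¹ : Equiv.Perm ι).injective⟩
  one_smul _ := rfl
  mul_smul _ _ _ := rfl

/-- A group acting on `X` acts on configurations pointwise. -/
instance pointAction {G : Type} [Group G] [MulAction G X] : MulAction G (Conf ι X) where
  smul g x := ⟨fun i => g • x.1 i, (MulAction.injective g).comp x.2⟩
  one_smul x := Subtype.ext (funext fun i => one_smul G (x.1 i))
  mul_smul g h x := Subtype.ext (funext fun i => mul_smul g h (x.1 i))

theorem perm_smul_apply (σ : Equiv.Perm ι) (x : Conf ι X) (i : ι) :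
    (σ • x).1 i = x.1 (σ⁻¹ i) := rfl

theorem point_smul_apply {G : Type} [Group G] [MulAction G X] (g : G) (x : Conf ι X) (i : ι) :
    (g • x).1 i = g • x.1 i := rfl

theorem perm_smul_point_smul {G : Type} [Group G] [MulAction G X] (σ : Equiv.Perm ι) (g : G)
    (x : Conf ι X) : σ • g • x = g • σ • x := rfl

end Conf

/-- The unordered configuration space `C_n(ℂ) = F_n(ℂ) / Σ_n`, with the quotient topology. -/
def UnorderedConf (n : ℕ) : Type :=
  MulAction.orbitRel.Quotient (Equiv.Perm (Fin n)) (Conf (Fin n) ℂ)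

instance (n : ℕ) : TopologicalSpace (UnorderedConf n) :=
  inferInstanceAs (TopologicalSpace (Quotient
    (MulAction.orbitRel (Equiv.Perm (Fin n)) (Conf (Fin n) ℂ))))

/-- `S¹` acts on `C_n(ℂ)` by rotating the configuration. -/
noncomputable instance (n : ℕ) : MulAction Circle (UnorderedConf n) where
  smul z := Quotient.map (z • ·) (by
    rintro _ y ⟨σ, rfl⟩
    exact ⟨σ, rfl⟩)
  one_smul x := by
    induction x using Quotient.inductionOn with
    | h x => exact congrArg (Quotient.mk _) (one_smul Circle x)
  mul_smul z w x := by
    induction x using Quotient.inductionOn with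
    | h x => exact congrArg (Quotient.mk _) (mul_smul z w x)

/-! ### The moduli space of genus zero curves with marked points -/

/-- The moduli space of genus zero Riemann surfaces with distinct marked points labelled by `ι`.
Every compact Riemann surface of genus zero is isomorphic to the Riemann sphere
`ℂ ∪ {∞}`, whose automorphisms are the Möbius transformations; so this is the space of injective
`ι`-tuples of points of the sphere modulo Möbius transformations, with the quotient topology.
The scalars in `GL₂(ℂ)` act trivially, so the quotient by `GL₂(ℂ)` is the one by `PGL₂(ℂ)`. -/
def ModuliZero (ι : Type) : Type :=
  MulAction.orbitRel.Quotient (GL (Fin 2) ℂ) (Conf ι (OnePoint ℂ))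

instance (ι : Type) : TopologicalSpace (ModuliZero ι) :=
  inferInstanceAs (TopologicalSpace (Quotient
    (MulAction.orbitRel (GL (Fin 2) ℂ) (Conf ι (OnePoint ℂ)))))

/-- Relabelling of the marked points. -/
noncomputable instance ModuliZero.permAction (ι : Type) : MulAction (Equiv.Perm ι) (ModuliZero ι) where
  smul σ := Quotient.map (σ • ·) (by
    rintro _ y ⟨g, rfl⟩
    exact ⟨g, rfl⟩)
  one_smul x := by
    induction x using Quotient.inductionOn with
    | h x => exact congrArg (Quotient.mk _) (one_smul (Equiv.Perm ι) x)
  mul_smul σ τ x := by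
    induction x using Quotient.inductionOn with
    | h x => exact congrArg (Quotient.mk _) (mul_smul σ τ x)

/-- `M_{0,n+1}`: the marked points are labelled by `Fin n` together with one extra label. -/
def ModuliZeroSucc (n : ℕ) : Type := ModuliZero (Option (Fin n))

instance (n : ℕ) : TopologicalSpace (ModuliZeroSucc n) :=
  inferInstanceAs (TopologicalSpace (ModuliZero (Option (Fin n))))

/-- The inclusion `Σ_n → Σ_{n+1}` as the permutations that fix the extra label. -/
def permSucc (n : ℕ) : Equiv.Perm (Fin n) →* Equiv.Perm (Option (Fin n)) where
  toFun σ := σ.optionCongr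
  map_one' := Equiv.optionCongr_refl
  map_mul' σ τ := Equiv.ext fun i => by cases i <;> rfl

/-- `Σ_n` acts on `M_{0,n+1}` by relabelling the first `n` points. -/
noncomputable instance (n : ℕ) : MulAction (Equiv.Perm (Fin n)) (ModuliZeroSucc n) :=
  MulAction.compHom (ModuliZero (Option (Fin n))) (permSucc n)

/-! ### Universal spaces, homotopy quotients and equivariant homology -/

/-- Milnor's universal `G`-space `EG = G * G * G * ⋯`: a point is a formal convex combination
`∑ tᵢ gᵢ`, with finitely many nonzero weights `tᵢ`, where `gᵢ ∈ G` is recorded only if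
`tᵢ ≠ 0`. -/
@[ext]
structure MilnorE (G : Type) where
  /-- the weights -/
  t : ℕ →₀ ℝ
  nonneg : ∀ i, 0 ≤ t i
  sum_eq_one : (t.sum fun _ r => r) = 1
  /-- the group elements, for the indices of nonzero weight -/
  g : ∀ i, t i ≠ 0 → G

namespace MilnorE

variable {G : Type}

/-- The coarsest topology for which all `tᵢ : EG → ℝ` and all
`gᵢ : {tᵢ ≠ 0} → G` are continuous. -/
instance [TopologicalSpace G] : TopologicalSpace (MilnorE G) :=
  TopologicalSpace.generateFrom
    ({S | ∃ (i : ℕ) (U : Set ℝ), IsOpen U ∧ S = {e | e.t i ∈ U}} ∪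
     {S | ∃ (i : ℕ) (V : Set G), IsOpen V ∧ S = {e | ∃ h : e.t i ≠ 0, e.g i h ∈ V}})

/-- `h • ∑ tᵢ gᵢ = ∑ tᵢ (h gᵢ)`. -/
instance [Group G] : MulAction G (MilnorE G) where
  smul h e := ⟨e.t, e.nonneg, e.sum_eq_one, fun i hi => h * e.g i hi⟩
  one_smul e := by
    cases e
    exact MilnorE.ext rfl (heq_of_eq (funext fun _ => funext fun _ => one_mul _))
  mul_smul h k e := by
    cases e
    exact MilnorE.ext rfl (heq_of_eq (funext fun _ => funext fun _ => mul_assoc _ _ _))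

end MilnorE

/-- The homotopy quotient `X_G = EG ×_G X`: the quotient of `EG × X` by the diagonal action. -/
def HomotopyQuotient (G X : Type) [Group G] [TopologicalSpace G] [TopologicalSpace X]
    [MulAction G X] : Type :=
  MulAction.orbitRel.Quotient G (MilnorE G × X)

instance (G X : Type) [Group G] [TopologicalSpace G] [TopologicalSpace X] [MulAction G X] :
    TopologicalSpace (HomotopyQuotient G X) :=
  inferInstanceAs (TopologicalSpace (Quotient (MulAction.orbitRel G (MilnorE G × X))))

/-- The symmetric group is a discrete group. -/
instance (n : ℕ) : TopologicalSpace (Equiv.Perm (Fin n)) := ⊥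

universe u

/-- Singular homology `H_k(X; A)` with coefficients in an `R`-module `A`, as a functor. -/
noncomputable def singularHomology (R : Type u) [CommRing R] (A : ModuleCat.{u} R) (k : ℕ) :
    TopCat.{0} ⥤ ModuleCat.{u} R :=
  (AlgebraicTopology.singularHomologyFunctor (ModuleCat.{u} R) k).obj A

/-- Equivariant homology `H_k^G(X; A) = H_k(X_G; A)`. -/
noncomputable def equivariantHomology (G X : Type) [Group G] [TopologicalSpace G]
    [TopologicalSpace X] [MulAction G X] (R : Type u) [CommRing R] (A : ModuleCat.{u} R) (k : ℕ) :
    ModuleCat.{u} R :=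
  (singularHomology R A k).obj (TopCat.of (HomotopyQuotient G X))

/-! Both spaces are models of the homotopy quotient of `F_n(ℂ)` by `Σ_n × S¹`. Putting the extra
marked point at `∞` identifies `M_{0,n+1}` with `F_n(ℂ)` modulo affine maps (`toModuli_eq_iff`). For
`n ≥ 2` a configuration can be normalised to barycentre `0` and radius `1`; what remains of the
affine group is then `S¹`. The actions of `S¹` and of `Σ_n` on `F_n(ℂ)` are free, so either quotient
may be replaced by a homotopy quotient.

The proof makes this explicit, without principal bundles. Freeness appears as equivariant maps to
universal spaces: the direction between two points gives `F_n(ℂ) → ES¹` (`directionE`), and sorting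
the points by several linear functionals gives `F_n(ℂ) → EΣ_n` (`sortE`). Neither is invariant under
the other group. Averaging over the Milnor space of that group, by means of an iterated join, makes
it so and keeps the equivariance (`toCircleE_smul`, `toPermE_smul`). The results are maps both ways
between `EΣ_n × F_n(ℂ)` and `ES¹ × F_n(ℂ)`.

Their composites are homotopic to the identity, compatibly with the quotients: in the universal
space because the two projections `EG × EG → EG` are equivariantly homotopic
(`equivariantHomotopic_fst_snd`), in the configuration by the straight-line path to its
normalisation. All projections are open quotient maps (for the moduli space this is
`isOpenQuotientMap_toModuli`), so maps and homotopies descend. The statement on homology is homotopy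
invariance. -/

/-! ### Maps into Milnor's universal space -/

/-- Finitely supported probability weights on `ℕ`. -/
def IsWeight (w : ℕ →₀ ℝ) : Prop := (∀ i, 0 ≤ w i) ∧ (w.sum fun _ r => r) = 1

namespace IsWeight

theorem le_one {w : ℕ →₀ ℝ} (hw : IsWeight w) (i : ℕ) : w i ≤ 1 := by
  by_cases hi : i ∈ w.support
  · rw [← hw.2]
    exact Finset.single_le_sum (f := fun i => w i) (fun j _ => hw.1 j) hi
  · rw [Finsupp.notMem_support_iff.1 hi]
    exact zero_le_one

theorem single (i : ℕ) : IsWeight (Finsupp.single i 1) := by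
  refine ⟨fun j => ?_, by simp⟩
  rw [Finsupp.single_apply]
  split_ifs <;> simp

theorem convex {v w : ℕ →₀ ℝ} (hv : IsWeight v) (hw : IsWeight w) {a b : ℝ} (ha : 0 ≤ a)
    (hb : 0 ≤ b) (hab : a + b = 1) : IsWeight (a • v + b • w) := by
  refine ⟨fun i => add_nonneg (mul_nonneg ha (hv.1 i)) (mul_nonneg hb (hw.1 i)), ?_⟩
  rw [Finsupp.sum_add_index' (fun _ => rfl) (fun _ _ _ => rfl), Finsupp.sum_smul_index (fun _ => rfl),
    Finsupp.sum_smul_index (fun _ => rfl), ← Finsupp.mul_sum, ← Finsupp.mul_sum, hv.2, hw.2]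
  simpa using hab

theorem mapDomain {w : ℕ →₀ ℝ} (hw : IsWeight w) (φ : ℕ → ℕ) :
    IsWeight (w.mapDomain φ) := by
  refine ⟨fun i => ?_, ?_⟩
  · rw [Finsupp.mapDomain, Finsupp.sum, Finsupp.finsetSum_apply]
    refine Finset.sum_nonneg fun j _ => ?_
    rw [Finsupp.single_apply]
    split_ifs
    · exact hw.1 j
    · exact le_rfl
  · rw [Finsupp.sum_mapDomain_index (fun _ => rfl) (fun _ _ _ => rfl)]
    exact hw.2

theorem bind {c : ℕ →₀ ℝ} (hc : IsWeight c) {v : ℕ → ℕ →₀ ℝ} (hv : ∀ i, IsWeight (v i)) :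
    IsWeight (c.sum fun i r => r • v i) := by
  refine ⟨fun j => ?_, ?_⟩
  · rw [Finsupp.sum_apply]
    exact Finset.sum_nonneg fun i _ => mul_nonneg (hc.1 i) ((hv i).1 j)
  · rw [Finsupp.sum_sum_index (fun _ => rfl) (fun _ _ _ => rfl), ← hc.2]
    refine Finsupp.sum_congr fun i _ => ?_
    rw [Finsupp.sum_smul_index (fun _ => rfl), ← Finsupp.mul_sum, (hv i).2, mul_one]

end IsWeight

namespace MilnorE

variable {G : Type}

theorem isWeight (e : MilnorE G) : IsWeight e.t := ⟨e.nonneg, e.sum_eq_one⟩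

theorem continuous_t [TopologicalSpace G] (i : ℕ) : Continuous fun e : MilnorE G => e.t i :=
  continuous_def.2 fun U hU => TopologicalSpace.isOpen_generateFrom_of_mem (Or.inl ⟨i, U, hU, rfl⟩)

variable [Group G]

open Classical in
/-- The group element at the index `i`, with the junk value `1` where the weight vanishes. -/
noncomputable def elt (e : MilnorE G) (i : ℕ) : G := if h : e.t i ≠ 0 then e.g i h else 1

theorem elt_eq (e : MilnorE G) {i : ℕ} (h : e.t i ≠ 0) : e.elt i = e.g i h := dif_pos h

/-- The point with given weights and group elements. -/
def ofWeights (t : ℕ →₀ ℝ) (ht : IsWeight t) (k : ℕ → G) : MilnorE G :=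
  ⟨t, ht.1, ht.2, fun i _ => k i⟩

theorem elt_ofWeights {t : ℕ →₀ ℝ} (ht : IsWeight t) (k : ℕ → G) {i : ℕ} (h : t i ≠ 0) :
    (ofWeights t ht k).elt i = k i :=
  elt_eq (ofWeights t ht k) h

/-- The total function `elt` removes the dependence of `g` on a proof that the weight is nonzero.
Comparison on the support suffices, so junk values never matter. -/
theorem ext_elt {a b : MilnorE G} (ht : a.t = b.t)
    (hg : ∀ i, a.t i ≠ 0 → a.elt i = b.elt i) : a = b := by
  have hg' : ∀ i (h : a.t i ≠ 0) (h' : b.t i ≠ 0), a.g i h = b.g i h' := fun i h h' => by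
    rw [← elt_eq, ← elt_eq, hg i h]
  cases a
  cases b
  cases ht
  exact MilnorE.ext rfl (heq_of_eq (funext fun i => funext fun h => hg' i h h))

@[simp] theorem smul_t (h : G) (e : MilnorE G) : (h • e).t = e.t := rfl

theorem elt_smul (h : G) (e : MilnorE G) {i : ℕ} (hi : e.t i ≠ 0) :
    (h • e).elt i = h * e.elt i := by
  rw [elt_eq _ hi, elt_eq (h • e) hi]
  rfl

section Topology

variable [TopologicalSpace G] {Z : Type} [TopologicalSpace Z]

theorem continuousAt_elt {e : MilnorE G} {i : ℕ} (h : e.t i ≠ 0) :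
    ContinuousAt (fun e : MilnorE G => e.elt i) e := by
  rw [continuousAt_def]
  intro A hA
  obtain ⟨V, hVA, hV, hVe⟩ := mem_nhds_iff.1 hA
  refine mem_nhds_iff.2 ⟨{e | ∃ h : e.t i ≠ 0, e.g i h ∈ V}, ?_,
    TopologicalSpace.isOpen_generateFrom_of_mem (Or.inr ⟨i, V, hV, rfl⟩), h, ?_⟩
  · rintro e' ⟨h', hV'⟩
    exact hVA (by rwa [← elt_eq] at hV')
  · rwa [← elt_eq]

/-- Continuity of `elt` can be asked only where the weight is nonzero: at the edge of the support it
jumps to the junk value. -/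
theorem continuous_of_t_of_elt {f : Z → MilnorE G} (ht : ∀ i, Continuous fun z => (f z).t i)
    (hg : ∀ z i, (f z).t i ≠ 0 → ContinuousAt (fun z => (f z).elt i) z) : Continuous f := by
  refine continuous_generateFrom_iff.2 ?_
  rintro _ (⟨i, U, hU, rfl⟩ | ⟨i, V, hV, rfl⟩)
  · exact hU.preimage (ht i)
  · refine isOpen_iff_mem_nhds.2 ?_
    rintro z ⟨h, hz⟩
    rw [← elt_eq] at hz
    filter_upwards [(ht i).continuousAt.eventually_ne h,
      (hg z i h).eventually (hV.mem_nhds hz)] with z' h' hz'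
    exact ⟨h', by rwa [← elt_eq]⟩

theorem continuous_ofWeights {t : Z → ℕ →₀ ℝ} (hw : ∀ z, IsWeight (t z)) {k : Z → ℕ → G}
    (ht : ∀ i, Continuous fun z => t z i)
    (hk : ∀ z i, t z i ≠ 0 → ContinuousAt (fun z => k z i) z) :
    Continuous fun z => ofWeights (t z) (hw z) (k z) := by
  refine continuous_of_t_of_elt ht fun z i h => (hk z i h).congr ?_
  filter_upwards [(ht i).continuousAt.eventually_ne h] with z' h'
  exact (elt_ofWeights _ _ h').symm

instance [IsTopologicalGroup G] : ContinuousConstSMul G (MilnorE G) where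
  continuous_const_smul h := by
    refine continuous_of_t_of_elt continuous_t fun e i hi => ?_
    have hc : ContinuousAt (fun e : MilnorE G => h * e.elt i) e :=
      ContinuousAt.mul continuousAt_const (continuousAt_elt hi)
    refine hc.congr ?_
    filter_upwards [(continuous_t i).continuousAt.eventually_ne hi] with e' h'
    exact (elt_smul h e' h').symm

end Topology

/-! ### Spreading out the indices -/

/-- The part of the weight at the index `i` that has moved at the time `s`. -/
noncomputable def movedPart (i : ℕ) (s : ℝ) : ℝ := max 0 (min 1 (2 ^ (i + 1) * s - 1))

theorem continuous_movedPart (i : ℕ) : Continuous (movedPart i) := by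
  unfold movedPart
  fun_prop

theorem movedPart_nonneg (i : ℕ) (s : ℝ) : 0 ≤ movedPart i s := le_max_left _ _

theorem movedPart_le_one (i : ℕ) (s : ℝ) : movedPart i s ≤ 1 :=
  max_le zero_le_one (min_le_left _ _)

@[simp] theorem movedPart_zero (i : ℕ) : movedPart i 0 = 0 := by simp [movedPart]

@[simp] theorem movedPart_one (i : ℕ) : movedPart i 1 = 1 := by
  have : (2 : ℝ) ≤ 2 ^ (i + 1) := by
    rw [pow_succ]
    linarith [one_le_pow₀ (n := i) (one_le_two : (1 : ℝ) ≤ 2)]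
  rw [movedPart, min_eq_left (by linarith), max_eq_right zero_le_one]

/-- The index `i` moves during the time interval `[2^{-(i+1)}, 2^{-i}]`, and these intervals meet
only at endpoints. So a slot `φ i > i` has lost its own weight before it receives any from `i`, and
never has to hold two group elements. -/
theorem movedPart_eq_one_of_lt {i j : ℕ} (hij : i < j) {s : ℝ} (h : movedPart i s ≠ 0) :
    movedPart j s = 1 := by
  have h1 : 0 < 2 ^ (i + 1) * s - 1 := by
    by_contra! h'
    exact h (max_eq_left ((min_le_right _ _).trans h'))
  have h2 : (2 : ℝ) * 2 ^ (i + 1) ≤ 2 ^ (j + 1) := by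
    rw [← pow_succ']
    exact pow_le_pow_right₀ one_le_two (by omega)
  have hs : 0 < s := by
    by_contra! hs
    nlinarith [pow_pos (two_pos : (0 : ℝ) < 2) (i + 1)]
  have : 1 ≤ 2 ^ (j + 1) * s - 1 := by nlinarith
  rw [movedPart, min_eq_left this, max_eq_right zero_le_one]

section Spread

variable (φ : ℕ → ℕ)

/-- The weights at the time `s` of the homotopy that moves the index `i` to `φ i`. -/
noncomputable def spreadWeight (s : ℝ) (w : ℕ →₀ ℝ) : ℕ →₀ ℝ :=
  w.sum fun i r => r • ((1 - movedPart i s) • Finsupp.single i (1 : ℝ) +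
    movedPart i s • Finsupp.single (φ i) (1 : ℝ))

theorem isWeight_spreadWeight (s : ℝ) {w : ℕ →₀ ℝ} (hw : IsWeight w) :
    IsWeight (spreadWeight φ s w) :=
  hw.bind fun i => (IsWeight.single _).convex (IsWeight.single _)
    (sub_nonneg.2 (movedPart_le_one i s)) (movedPart_nonneg i s) (by ring)

variable {φ}

theorem spreadWeight_apply_notMem (s : ℝ) (w : ℕ →₀ ℝ) {j : ℕ} (hj : j ∉ Set.range φ) :
    spreadWeight φ s w j = w j * (1 - movedPart j s) := by
  have hj' : ∀ i, φ i ≠ j := fun i h => hj ⟨i, h⟩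
  simp only [spreadWeight, Finsupp.sum, Finsupp.finsetSum_apply, Finsupp.smul_apply, Finsupp.add_apply,
    Finsupp.single_apply, smul_eq_mul, if_neg (hj' _)]
  simp only [mul_ite, mul_one, mul_zero, add_zero, Finset.sum_ite_eq', Finsupp.mem_support_iff]
  split_ifs with h
  · rfl
  · rw [not_not.1 h, zero_mul]

theorem spreadWeight_apply (hφ : Function.Injective φ) (s : ℝ) (w : ℕ →₀ ℝ) (i : ℕ) :
    spreadWeight φ s w (φ i) = w (φ i) * (1 - movedPart (φ i) s) + w i * movedPart i s := by
  simp only [spreadWeight, Finsupp.sum, Finsupp.finsetSum_apply, Finsupp.smul_apply, Finsupp.add_apply,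
    Finsupp.single_apply, smul_eq_mul, hφ.eq_iff]
  simp only [mul_add, mul_ite, mul_one, mul_zero, Finset.sum_add_distrib, Finset.sum_ite_eq',
    Finsupp.mem_support_iff]
  congr 1
  · split_ifs with h
    · rfl
    · rw [not_not.1 h, zero_mul]
  · split_ifs with h
    · rfl
    · rw [not_not.1 h, zero_mul]

open Classical in
/-- The homotopy that moves the index `i` to `φ i`, larger indices first. -/
noncomputable def spread (φ : ℕ → ℕ) (s : ℝ) (e : MilnorE G) : MilnorE G :=
  ofWeights (spreadWeight φ s e.t) (isWeight_spreadWeight φ s e.isWeight) fun j =>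
    if e.t j * (1 - movedPart j s) = 0 then e.elt (Function.invFun φ j) else e.elt j

theorem spread_t (s : ℝ) (e : MilnorE G) : (spread φ s e).t = spreadWeight φ s e.t := rfl

open Classical in
theorem spread_elt (s : ℝ) (e : MilnorE G) {j : ℕ} (hj : (spread φ s e).t j ≠ 0) :
    (spread φ s e).elt j =
      if e.t j * (1 - movedPart j s) = 0 then e.elt (Function.invFun φ j) else e.elt j :=
  elt_ofWeights _ _ hj

theorem spread_zero (φ : ℕ → ℕ) (e : MilnorE G) : spread φ 0 e = e := by
  have ht : spreadWeight φ 0 e.t = e.t := by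
    simp [spreadWeight]
  refine ext_elt ht fun i hi => ?_
  have hi' : e.t i ≠ 0 := ht ▸ hi
  rw [spread_elt _ _ hi]
  simp [hi']

theorem spread_one_t_of_notMem (e : MilnorE G) {j : ℕ} (hj : j ∉ Set.range φ) :
    (spread φ 1 e).t j = 0 := by
  rw [spread_t, spreadWeight_apply_notMem _ _ hj]
  simp

/-- Weight in a slot whose own contribution is gone must have arrived from its preimage under `φ`.
This justifies the use of `Function.invFun` in `spread`. -/
theorem exists_of_spreadWeight_ne_zero (hφ : Function.Injective φ) {s : ℝ} {w : ℕ →₀ ℝ} {j : ℕ}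
    (h : spreadWeight φ s w j ≠ 0) (h0 : w j * (1 - movedPart j s) = 0) :
    ∃ i, φ i = j ∧ w i ≠ 0 ∧ movedPart i s ≠ 0 := by
  by_cases hj : j ∈ Set.range φ
  · obtain ⟨i, rfl⟩ := hj
    rw [spreadWeight_apply hφ, h0, zero_add] at h
    exact ⟨i, rfl, left_ne_zero_of_mul h, right_ne_zero_of_mul h⟩
  · exact absurd h0 (by rwa [← spreadWeight_apply_notMem s w hj])

theorem spread_smul (hφ : Function.Injective φ) (s : ℝ) (h : G) (e : MilnorE G) :
    spread φ s (h • e) = h • spread φ s e := by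
  refine ext_elt rfl fun j hj => ?_
  have hj' : (spread φ s e).t j ≠ 0 := hj
  rw [elt_smul _ _ hj', spread_elt _ _ hj, spread_elt _ _ hj', smul_t]
  split_ifs with h0
  · obtain ⟨i, rfl, hi, -⟩ := exists_of_spreadWeight_ne_zero hφ hj h0
    rw [Function.leftInverse_invFun hφ]
    exact elt_smul _ _ hi
  · exact elt_smul _ _ (left_ne_zero_of_mul h0)

theorem continuous_spread [TopologicalSpace G] (hφ : Function.Injective φ) (hlt : ∀ i, i < φ i) :
    Continuous fun z : ℝ × MilnorE G => spread φ z.1 z.2 := by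
  have ct : ∀ i, Continuous fun z : ℝ × MilnorE G => z.2.t i := fun i =>
    (continuous_t i).comp continuous_snd
  have cm : ∀ i, Continuous fun z : ℝ × MilnorE G => movedPart i z.1 := fun i =>
    (continuous_movedPart i).comp continuous_fst
  refine continuous_ofWeights _ (fun j => ?_) fun z j hj => ?_
  · by_cases hj : j ∈ Set.range φ
    · obtain ⟨i, rfl⟩ := hj
      simp only [spreadWeight_apply hφ]
      exact ((ct _).mul (continuous_const.sub (cm _))).add ((ct _).mul (cm _))
    · simp only [spreadWeight_apply_notMem _ _ hj]
      exact (ct _).mul (continuous_const.sub (cm _))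
  · by_cases h0 : z.2.t j * (1 - movedPart j z.1) = 0
    · obtain ⟨i, rfl, hi, hm⟩ := exists_of_spreadWeight_ne_zero hφ hj h0
      have : ContinuousAt (fun z : ℝ × MilnorE G => z.2.elt i) z :=
        ContinuousAt.comp (f := Prod.snd) (continuousAt_elt hi) continuousAt_snd
      refine this.congr ?_
      -- While `i` is moving, `φ i` has been emptied, so the same branch of the definition applies
      -- in a whole neighbourhood.
      filter_upwards [(cm i).continuousAt.eventually_ne hm] with z' hm'
      rw [if_pos (by rw [movedPart_eq_one_of_lt (hlt i) hm']; simp),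
        Function.leftInverse_invFun hφ]
    · have : ContinuousAt (fun z : ℝ × MilnorE G => z.2.elt j) z :=
        ContinuousAt.comp (f := Prod.snd) (continuousAt_elt (left_ne_zero_of_mul h0))
          continuousAt_snd
      refine this.congr ?_
      filter_upwards [((ct j).mul (continuous_const.sub (cm j))).continuousAt.eventually_ne h0]
        with z' h'
      exact (if_neg h').symm

theorem _root_.Continuous.milnorE_spread [TopologicalSpace G] {Z : Type} [TopologicalSpace Z]
    (hφ : Function.Injective φ) (hlt : ∀ i, i < φ i) {s : Z → ℝ} {a : Z → MilnorE G}
    (hs : Continuous s) (ha : Continuous a) : Continuous fun z => spread φ (s z) (a z) := by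
  have h := (continuous_spread (G := G) hφ hlt).comp (hs.prodMk ha)
  exact h

end Spread

/-! ### Joins -/

section Join

variable (D : Set ℕ)

open Classical in
/-- The point `(1 - s) a + s b` of the join, for `a` supported in `D` and `b` in the
complement. -/
noncomputable def join (s : unitInterval) (a b : MilnorE G) : MilnorE G :=
  ofWeights ((1 - (s : ℝ)) • a.t + (s : ℝ) • b.t)
    (a.isWeight.convex b.isWeight (sub_nonneg.2 s.2.2) s.2.1 (by ring))
    fun j => if j ∈ D then a.elt j else b.elt j

variable {D}

theorem join_t (s : unitInterval) (a b : MilnorE G) (j : ℕ) :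
    (join D s a b).t j = (1 - (s : ℝ)) * a.t j + s * b.t j := rfl

open Classical in
theorem join_elt (s : unitInterval) (a b : MilnorE G) {j : ℕ} (hj : (join D s a b).t j ≠ 0) :
    (join D s a b).elt j = if j ∈ D then a.elt j else b.elt j :=
  elt_ofWeights _ _ hj

theorem join_zero {a b : MilnorE G} (ha : ∀ j ∉ D, a.t j = 0) : join D 0 a b = a := by
  have ht : (join D 0 a b).t = a.t := by ext j; simp [join_t]
  refine ext_elt ht fun j hj => ?_
  rw [join_elt _ _ _ hj, if_pos]
  by_contra h
  exact hj (by rw [ht, ha j h])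

theorem join_one {a b : MilnorE G} (hb : ∀ j ∈ D, b.t j = 0) : join D 1 a b = b := by
  have ht : (join D 1 a b).t = b.t := by ext j; simp [join_t]
  refine ext_elt ht fun j hj => ?_
  rw [join_elt _ _ _ hj, if_neg]
  intro h
  exact hj (by rw [ht, hb j h])

/-- Disjoint supports ensure that the group element selected at a live index belongs to a nonzero
weight; the junk value `1` is not equivariant. -/
theorem join_smul (s : unitInterval) (h : G) {a b : MilnorE G} (ha : ∀ j ∉ D, a.t j = 0)
    (hb : ∀ j ∈ D, b.t j = 0) : join D s (h • a) (h • b) = h • join D s a b := by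
  refine ext_elt rfl fun j hj => ?_
  have hj' : (join D s a b).t j ≠ 0 := hj
  rw [elt_smul _ _ hj', join_elt _ _ _ hj, join_elt _ _ _ hj']
  rw [join_t] at hj'
  split_ifs with hD
  · rw [hb j hD, mul_zero, add_zero] at hj'
    exact elt_smul _ _ (right_ne_zero_of_mul hj')
  · rw [ha j hD, mul_zero, zero_add] at hj'
    exact elt_smul _ _ (right_ne_zero_of_mul hj')

theorem continuous_join [TopologicalSpace G] {Z : Type} [TopologicalSpace Z]
    {s : Z → unitInterval} {a b : Z → MilnorE G} (hs : Continuous s) (ha : Continuous a)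
    (hb : Continuous b) (haD : ∀ z, ∀ j ∉ D, (a z).t j = 0) (hbD : ∀ z, ∀ j ∈ D, (b z).t j = 0) :
    Continuous fun z => join D (s z) (a z) (b z) := by
  refine continuous_ofWeights _ (fun j => ?_) fun z j hj => ?_
  · have h1 := (continuous_t j).comp ha
    have h2 := (continuous_t j).comp hb
    have h3 : Continuous fun z => (s z : ℝ) := continuous_subtype_val.comp hs
    exact ((continuous_const.sub h3).mul h1).add (h3.mul h2)
  · change (1 - (s z : ℝ)) * (a z).t j + s z * (b z).t j ≠ 0 at hj
    by_cases hD : j ∈ D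
    · simp only [if_pos hD]
      rw [hbD z j hD, mul_zero, add_zero] at hj
      exact ContinuousAt.comp (f := a) (continuousAt_elt (right_ne_zero_of_mul hj)) ha.continuousAt
    · simp only [if_neg hD]
      rw [haD z j hD, mul_zero, zero_add] at hj
      exact ContinuousAt.comp (f := b) (continuousAt_elt (right_ne_zero_of_mul hj)) hb.continuousAt

end Join

/-- Two maps `EG × EG → EG` that are equivariantly homotopic. -/
def EquivariantHomotopic [TopologicalSpace G] (p q : C(MilnorE G × MilnorE G, MilnorE G)) : Prop :=
  HomotopicWith p q fun k => ∀ (h : G) (a b : MilnorE G), k (h • a, h • b) = h • k (a, b)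

theorem equivariantHomotopic_of_continuous [TopologicalSpace G]
    {p q : C(MilnorE G × MilnorE G, MilnorE G)}
    (K : unitInterval → MilnorE G → MilnorE G → MilnorE G)
    (hK : Continuous fun z : unitInterval × (MilnorE G × MilnorE G) => K z.1 z.2.1 z.2.2)
    (h0 : ∀ a b, K 0 a b = p (a, b)) (h1 : ∀ a b, K 1 a b = q (a, b))
    (hG : ∀ s (h : G) a b, K s (h • a) (h • b) = h • K s a b) : EquivariantHomotopic p q :=
  ⟨{ toFun := fun z => K z.1 z.2.1 z.2.2
     continuous_toFun := hK
     map_zero_left := fun z => h0 z.1 z.2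
     map_one_left := fun z => h1 z.1 z.2
     prop' := fun s h a b => hG s h a b }⟩

theorem equivariantHomotopic_spread [TopologicalSpace G] {φ : ℕ → ℕ} (hφ : Function.Injective φ)
    (hlt : ∀ i, i < φ i) (f p : C(MilnorE G × MilnorE G, MilnorE G))
    (hf : ∀ (h : G) a b, f (h • a, h • b) = h • f (a, b))
    (hp : ∀ z, p z = spread φ 1 (f z)) : EquivariantHomotopic f p := by
  have hc : Continuous fun z : unitInterval × (MilnorE G × MilnorE G) =>
      spread φ z.1 (f (z.2.1, z.2.2)) :=
    (continuous_subtype_val.comp continuous_fst).milnorE_spread hφ hlt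
      (f.continuous.comp continuous_snd)
  refine equivariantHomotopic_of_continuous (fun s a b => spread φ s (f (a, b))) hc
    (fun a b => ?_) (fun a b => ?_) fun s h a b => ?_
  · rw [Set.Icc.coe_zero, spread_zero]
  · rw [Set.Icc.coe_one, hp]
  · rw [hf, spread_smul hφ]

/-- Any two equivariant maps to `EG` are equivariantly homotopic, in the universal form: the two
projections of `EG × EG` are. -/
theorem equivariantHomotopic_fst_snd (G : Type) [Group G] [TopologicalSpace G] :
    EquivariantHomotopic (ContinuousMap.fst : C(MilnorE G × MilnorE G, MilnorE G))
      ContinuousMap.snd := by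
  obtain ⟨φ, ψ, hφ, hψ, hφ', hψ', hD⟩ : ∃ φ ψ : ℕ → ℕ, Function.Injective φ ∧
      Function.Injective ψ ∧ (∀ i, i < φ i) ∧ (∀ i, i < ψ i) ∧
      ∀ j ∈ Set.range φ, j ∉ Set.range ψ := by
    -- The even slots are `2 * i + 2` rather than `2 * i` because every index, including `0`, must
    -- strictly increase.
    refine ⟨fun i => 2 * i + 1, fun i => 2 * i + 2, fun i j h => ?_, fun i j h => ?_,
      fun i => ?_, fun i => ?_, ?_⟩
    · dsimp only at h; omega
    · dsimp only at h; omega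
    · dsimp only; omega
    · dsimp only; omega
    · rintro _ ⟨i, rfl⟩ ⟨k, hk⟩
      dsimp only at hk
      omega
  have dφ : ∀ a : MilnorE G, ∀ j ∉ Set.range φ, (spread φ 1 a).t j = 0 := fun a j hj =>
    spread_one_t_of_notMem a hj
  have dψ : ∀ a : MilnorE G, ∀ j ∈ Set.range φ, (spread ψ 1 a).t j = 0 := fun a j hj =>
    spread_one_t_of_notMem a (hD j hj)
  let p : C(MilnorE G × MilnorE G, MilnorE G) := ⟨fun z => spread φ 1 z.1,
    continuous_const.milnorE_spread hφ hφ' continuous_fst⟩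
  let q : C(MilnorE G × MilnorE G, MilnorE G) := ⟨fun z => spread ψ 1 z.2,
    continuous_const.milnorE_spread hψ hψ' continuous_snd⟩
  have hc : Continuous fun z : unitInterval × (MilnorE G × MilnorE G) =>
      join (Set.range φ) z.1 (spread φ 1 z.2.1) (spread ψ 1 z.2.2) :=
    continuous_join continuous_fst
      (continuous_const.milnorE_spread hφ hφ' (continuous_fst.comp continuous_snd))
      (continuous_const.milnorE_spread hψ hψ' (continuous_snd.comp continuous_snd))
      (fun z => dφ z.2.1) (fun z => dψ z.2.2)
  have hpq : EquivariantHomotopic p q :=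
    equivariantHomotopic_of_continuous
      (fun s a b => join (Set.range φ) s (spread φ 1 a) (spread ψ 1 b)) hc
      (fun a b => join_zero (dφ a)) (fun a b => join_one (dψ b))
      (fun s h a b => by rw [spread_smul hφ, spread_smul hψ, join_smul s h (dφ a) (dψ b)])
  have hp : EquivariantHomotopic ContinuousMap.fst p :=
    equivariantHomotopic_spread hφ hφ' _ p (fun _ _ _ => rfl) fun _ => rfl
  have hq : EquivariantHomotopic ContinuousMap.snd q :=
    equivariantHomotopic_spread hψ hψ' _ q (fun _ _ _ => rfl) fun _ => rfl
  -- Once the two points are spread to odd and even slots, the segment between them in the join is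
  -- well defined.
  exact (HomotopicWith.trans hp hpq).trans (HomotopicWith.symm hq)

/-! ### Averaging an equivariant map over a second group -/

section Average

variable {H X : Type} [Group H] [MulAction H X]

/-- For `u : X → EG`, the point `∑ tᵢ u(hᵢ⁻¹ x)` of the iterated join `EG * EG * ⋯ = EG`. -/
noncomputable def average (u : X → MilnorE G) (e : MilnorE H) (x : X) : MilnorE G :=
  ofWeights (e.t.sum fun i r => r • (u ((e.elt i)⁻¹ • x)).t.mapDomain (Nat.pair i))
    (e.isWeight.bind fun i => (u ((e.elt i)⁻¹ • x)).isWeight.mapDomain _)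
    fun j => (u ((e.elt j.unpair.1)⁻¹ • x)).elt j.unpair.2

theorem average_t (u : X → MilnorE G) (e : MilnorE H) (x : X) (j : ℕ) :
    (average u e x).t j =
      e.t j.unpair.1 * (u ((e.elt j.unpair.1)⁻¹ • x)).t j.unpair.2 := by
  obtain ⟨i, m, rfl⟩ : ∃ i m, j = Nat.pair i m := ⟨_, _, (Nat.pair_unpair j).symm⟩
  rw [Nat.unpair_pair]
  change (Finsupp.sum e.t fun i r => r • (u ((e.elt i)⁻¹ • x)).t.mapDomain (Nat.pair i)) _ = _
  rw [Finsupp.sum_apply]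
  simp only [Finsupp.smul_apply, smul_eq_mul]
  have inj : Function.Injective (Nat.pair i) := fun a b h => (Nat.pair_eq_pair.1 h).2
  rw [Finsupp.sum_eq_single i, Finsupp.mapDomain_apply inj]
  · intro i' _ hi'
    rw [Finsupp.mapDomain_of_notMem_range, mul_zero]
    rintro ⟨b, hb⟩
    exact hi' (Nat.pair_eq_pair.1 hb).1
  · intro _
    rw [zero_mul]

theorem average_elt (u : X → MilnorE G) (e : MilnorE H) (x : X) {j : ℕ}
    (hj : (average u e x).t j ≠ 0) :
    (average u e x).elt j = (u ((e.elt j.unpair.1)⁻¹ • x)).elt j.unpair.2 :=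
  elt_ofWeights _ _ hj

/-- Each term is unchanged, since `(h hᵢ)⁻¹ h x = hᵢ⁻¹ x`. -/
theorem average_smul_smul (u : X → MilnorE G) (h : H) (e : MilnorE H) (x : X) :
    average u (h • e) (h • x) = average u e x := by
  have key : ∀ i, e.t i ≠ 0 → ((h • e).elt i)⁻¹ • h • x = (e.elt i)⁻¹ • x := fun i hi => by
    rw [elt_smul _ _ hi, mul_inv_rev, mul_smul, inv_smul_smul]
  have ht : (average u (h • e) (h • x)).t = (average u e x).t := by
    ext j
    rw [average_t, average_t, smul_t]
    by_cases hi : e.t j.unpair.1 = 0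
    · rw [hi, zero_mul, zero_mul]
    · rw [key _ hi]
  refine ext_elt ht fun j hj => ?_
  have hj' := hj
  rw [average_t] at hj'
  rw [average_elt _ _ _ hj, average_elt _ _ _ (ht ▸ hj), key _ (left_ne_zero_of_mul hj')]

/-- The hypothesis runs over the whole `H`-orbit because `average` evaluates `u` at the translates
`hᵢ⁻¹ x`. No action of `G` on `X` is needed. -/
theorem average_smul_right {u : X → MilnorE G} {g : G} {x x' : X}
    (hu : ∀ h : H, u (h • x') = g • u (h • x)) (e : MilnorE H) :
    average u e x' = g • average u e x := by
  have ht : (average u e x').t = (g • average u e x).t := by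
    ext j
    rw [smul_t, average_t, average_t, hu, smul_t]
  refine ext_elt ht fun j hj => ?_
  have hj' : (average u e x).t j ≠ 0 := ht ▸ hj
  rw [elt_smul _ _ hj', average_elt _ _ _ hj, average_elt _ _ _ hj', hu, elt_smul]
  rw [average_t] at hj'
  exact right_ne_zero_of_mul hj'

theorem continuous_average [TopologicalSpace G] [TopologicalSpace H] [IsTopologicalGroup H]
    [TopologicalSpace X] [ContinuousSMul H X] {u : X → MilnorE G} (hu : Continuous u) :
    Continuous fun z : MilnorE H × X => average u z.1 z.2 := by
  have cx : ∀ i (z : MilnorE H × X), z.1.t i ≠ 0 →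
      ContinuousAt (fun z : MilnorE H × X => (z.1.elt i)⁻¹ • z.2) z := fun i z hi =>
    (ContinuousAt.comp (f := Prod.fst) (continuousAt_elt hi) continuousAt_fst).inv.smul
      continuousAt_snd
  have ct : ∀ i, Continuous fun z : MilnorE H × X => z.1.t i := fun i =>
    (continuous_t i).comp continuous_fst
  refine continuous_of_t_of_elt (fun j => ?_) fun z j hj => ?_
  · simp only [average_t]
    refine continuous_iff_continuousAt.2 fun z => ?_
    by_cases hi : z.1.t j.unpair.1 = 0
    -- Where the outer weight vanishes, `elt` may jump and the inner weight with it; but the inner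
    -- weight is at most `1`, so the product still tends to `0`.
    · have h0 : Filter.Tendsto (fun z : MilnorE H × X => z.1.t j.unpair.1) (nhds z) (nhds 0) :=
        hi ▸ (ct j.unpair.1).tendsto z
      rw [ContinuousAt, hi, zero_mul]
      refine squeeze_zero (fun z => mul_nonneg (z.1.nonneg _) (MilnorE.nonneg _ _)) (fun z => ?_) h0
      exact mul_le_of_le_one_right (z.1.nonneg _) ((isWeight _).le_one _)
    · exact (ct _).continuousAt.mul (((continuous_t _).comp hu).continuousAt.comp (cx _ z hi))
  · have hj' := hj
    rw [average_t] at hj'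
    have h1 : ContinuousAt (fun z : MilnorE H × X =>
        (u ((z.1.elt j.unpair.1)⁻¹ • z.2)).elt j.unpair.2) z :=
      ContinuousAt.comp (f := fun z : MilnorE H × X => u ((z.1.elt j.unpair.1)⁻¹ • z.2))
        (continuousAt_elt (right_ne_zero_of_mul hj'))
        (hu.continuousAt.comp (cx _ z (left_ne_zero_of_mul hj')))
    refine h1.congr ?_
    have cav : ContinuousAt (fun z : MilnorE H × X => (average u z.1 z.2).t j) z := by
      simp only [average_t]
      exact (ct _).continuousAt.mul (((continuous_t _).comp hu).continuousAt.comp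
        (cx _ z (left_ne_zero_of_mul hj')))
    filter_upwards [cav.eventually_ne hj] with z' h'
    exact (average_elt _ _ _ h').symm

end Average

end MilnorE

/-! ### Equivariant maps from configurations to universal spaces -/

/-- The direction `w / |w|` of a nonzero complex number. -/
noncomputable def Circle.direction (w : ℂ) (hw : w ≠ 0) : Circle :=
  ⟨w / ‖w‖, mem_sphere_zero_iff_norm.2 (by simp [hw])⟩

theorem Circle.coe_direction (w : ℂ) (hw : w ≠ 0) : (Circle.direction w hw : ℂ) = w / ‖w‖ := rfl

instance permDiscreteTopology (n : ℕ) : DiscreteTopology (Equiv.Perm (Fin n)) := ⟨rfl⟩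

instance permIsTopologicalGroup (n : ℕ) : IsTopologicalGroup (Equiv.Perm (Fin n)) where
  continuous_mul := continuous_of_discreteTopology
  continuous_inv := continuous_of_discreteTopology

namespace Conf

theorem continuous_apply {ι X : Type} [TopologicalSpace X] (i : ι) :
    Continuous fun x : Conf ι X => x.1 i :=
  (_root_.continuous_apply i).comp continuous_subtype_val

theorem continuous_of_apply {Z ι X : Type} [TopologicalSpace X] [TopologicalSpace Z]
    {f : Z → Conf ι X} (hf : ∀ i, Continuous fun z => (f z).1 i) : Continuous f :=
  continuous_induced_rng.2 (continuous_pi hf)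

instance {ι X : Type} [TopologicalSpace X] {G : Type} [Group G] [TopologicalSpace G]
    [MulAction G X] [ContinuousSMul G X] : ContinuousSMul G (Conf ι X) where
  continuous_smul := continuous_of_apply fun i =>
    continuous_fst.smul ((continuous_apply i).comp continuous_snd)

instance {n : ℕ} {X : Type} [TopologicalSpace X] :
    ContinuousSMul (Equiv.Perm (Fin n)) (Conf (Fin n) X) where
  continuous_smul := by
    refine continuous_prod_of_discrete_left.2 fun σ => continuous_of_apply fun i => ?_
    exact continuous_apply (σ⁻¹ i)

theorem sub_ne_zero {ι : Type} (x : Conf ι ℂ) {i j : ι} (h : i ≠ j) : x.1 i - x.1 j ≠ 0 :=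
  _root_.sub_ne_zero.2 (x.2.ne h)

/-- The direction from the `j`-th to the `i`-th point, as a map to the universal `S¹`-space. -/
noncomputable def directionE {ι : Type} {i j : ι} (h : i ≠ j) (x : Conf ι ℂ) : MilnorE Circle :=
  MilnorE.ofWeights (Finsupp.single 0 1) (IsWeight.single 0) fun _ =>
    Circle.direction (x.1 i - x.1 j) (x.sub_ne_zero h)

theorem continuous_directionE {ι : Type} {i j : ι} (h : i ≠ j) :
    Continuous (directionE h) := by
  refine MilnorE.continuous_ofWeights _ (fun _ => continuous_const) fun x _ _ => ?_
  refine Continuous.continuousAt (continuous_induced_rng.2 ?_)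
  have hc := (continuous_apply (X := ℂ) i).sub (continuous_apply j)
  exact hc.div (Complex.continuous_ofReal.comp hc.norm) fun x => by
    simpa using x.sub_ne_zero h

theorem directionE_elt {ι : Type} {i j : ι} (h : i ≠ j) (x : Conf ι ℂ) {m : ℕ}
    (hm : (directionE h x).t m ≠ 0) :
    (directionE h x).elt m = Circle.direction (x.1 i - x.1 j) (x.sub_ne_zero h) :=
  MilnorE.elt_ofWeights _ _ hm

theorem directionE_smul {ι : Type} {i j : ι} (h : i ≠ j) (z : Circle) (x : Conf ι ℂ) :
    directionE h (z • x) = z • directionE h x := by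
  refine MilnorE.ext_elt rfl fun m hm => ?_
  have hm' : (directionE h x).t m ≠ 0 := hm
  rw [MilnorE.elt_smul _ _ hm', directionE_elt _ _ hm, directionE_elt _ _ hm']
  refine Circle.ext ?_
  rw [Circle.coe_mul, Circle.coe_direction, Circle.coe_direction]
  simp only [point_smul_apply, Circle.smul_def, smul_eq_mul, ← mul_sub, norm_mul,
    Circle.norm_coe, one_mul, mul_div_assoc]

/-! ### Sorting the points: the equivariant map from configurations to `EΣ_n` -/

section Sorting

variable {n : ℕ}

/-- A family of linear functionals on `ℂ`, applied to the points of a configuration. -/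
def height (m : ℕ) (x : Conf (Fin n) ℂ) (i : Fin n) : ℝ := (x.1 i).re + m * (x.1 i).im

theorem continuous_height (m : ℕ) (i : Fin n) :
    Continuous fun x : Conf (Fin n) ℂ => height m x i :=
  (Complex.continuous_re.comp (continuous_apply i)).add
    (continuous_const.mul (Complex.continuous_im.comp (continuous_apply i)))

theorem height_perm_smul (m : ℕ) (σ : Equiv.Perm (Fin n)) (x : Conf (Fin n) ℂ) (i : Fin n) :
    height m (σ • x) i = height m x (σ⁻¹ i) := rfl

/-- The product of the differences of the heights. -/
def heightGap (m : ℕ) (x : Conf (Fin n) ℂ) : ℝ :=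
  ∏ p : Fin n × Fin n, if p.1 = p.2 then 1 else |height m x p.1 - height m x p.2|

theorem continuous_heightGap (m : ℕ) : Continuous (heightGap m : Conf (Fin n) ℂ → ℝ) := by
  refine continuous_finsetProd _ fun p _ => ?_
  split_ifs
  · exact continuous_const
  · exact ((continuous_height m p.1).sub (continuous_height m p.2)).abs

theorem heightGap_nonneg (m : ℕ) (x : Conf (Fin n) ℂ) : 0 ≤ heightGap m x :=
  Finset.prod_nonneg fun p _ => by split_ifs <;> positivity

theorem heightGap_perm_smul (m : ℕ) (σ : Equiv.Perm (Fin n)) (x : Conf (Fin n) ℂ) :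
    heightGap m (σ • x) = heightGap m x :=
  Fintype.prod_equiv (Equiv.prodCongr σ⁻¹ σ⁻¹) _ _ fun p => by
    simp [height_perm_smul]

theorem heightGap_ne_zero_iff (m : ℕ) (x : Conf (Fin n) ℂ) :
    heightGap m x ≠ 0 ↔ Function.Injective (height m x) := by
  rw [heightGap, Finset.prod_ne_zero_iff]
  refine ⟨fun h i j hij => ?_, fun h p _ => ?_⟩
  · by_contra hne
    simpa [hne, hij] using h (i, j) (Finset.mem_univ _)
  · split_ifs with hp
    · exact one_ne_zero
    · exact abs_ne_zero.2 (_root_.sub_ne_zero.2 (h.ne hp))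

/-- Two distinct points have equal height for at most one `m`. There are `n * n` ordered pairs, so
among `n * n + 1` functionals one separates all points. -/
theorem exists_heightGap_ne_zero (x : Conf (Fin n) ℂ) :
    ∃ m ∈ Finset.range (n * n + 1), heightGap m x ≠ 0 := by
  by_contra! h
  have key : ∀ m : Fin (n * n + 1), ∃ p : Fin n × Fin n,
      p.1 ≠ p.2 ∧ height m x p.1 = height m x p.2 := fun m => by
    have := mt (heightGap_ne_zero_iff m x).2 (not_not.2 (h m (Finset.mem_range.2 m.2)))
    simp only [Function.Injective, not_forall] at this
    obtain ⟨i, j, hij, hne⟩ := this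
    exact ⟨(i, j), hne, hij⟩
  choose p hp1 hp2 using key
  -- By pigeonhole one pair collides for two values of `m`. This forces equal imaginary parts, then
  -- equal real parts.
  obtain ⟨k, l, hkl, hpkl⟩ := Fintype.exists_ne_map_eq_of_card_lt p (by simp)
  have e1 := hp2 k
  have e2 := hp2 l
  rw [← hpkl] at e2
  unfold height at e1 e2
  have him : (x.1 (p k).1).im = (x.1 (p k).2).im := by
    have : ((k : ℕ) - (l : ℕ) : ℝ) * ((x.1 (p k).1).im - (x.1 (p k).2).im) = 0 := by
      linear_combination e1 - e2
    rcases mul_eq_zero.1 this with h0 | h0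
    · exact absurd (Fin.ext (Nat.cast_injective (_root_.sub_eq_zero.1 h0))) hkl
    · exact _root_.sub_eq_zero.1 h0
  rw [him] at e1
  exact hp1 k (x.2 (Complex.ext (by linarith) him))

theorem sum_heightGap_pos (x : Conf (Fin n) ℂ) :
    0 < ∑ m ∈ Finset.range (n * n + 1), heightGap m x := by
  obtain ⟨m, hm, h⟩ := exists_heightGap_ne_zero x
  exact Finset.sum_pos' (fun m _ => heightGap_nonneg m x)
    ⟨m, hm, lt_of_le_of_ne (heightGap_nonneg m x) h.symm⟩

/-- The normalised gaps. -/
noncomputable def heightWeight (x : Conf (Fin n) ℂ) : ℕ →₀ ℝ :=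
  Finsupp.onFinset (Finset.range (n * n + 1))
    (fun m => if m ∈ Finset.range (n * n + 1) then
      heightGap m x / ∑ m ∈ Finset.range (n * n + 1), heightGap m x else 0)
    fun m hm => by
      by_contra h
      exact hm (if_neg h)

theorem heightWeight_apply (x : Conf (Fin n) ℂ) (m : ℕ) :
    heightWeight x m = if m ∈ Finset.range (n * n + 1) then
      heightGap m x / ∑ m ∈ Finset.range (n * n + 1), heightGap m x else 0 := rfl

theorem isWeight_heightWeight (x : Conf (Fin n) ℂ) : IsWeight (heightWeight x) := by
  refine ⟨fun m => ?_, ?_⟩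
  · rw [heightWeight_apply]
    split_ifs
    · exact div_nonneg (heightGap_nonneg m x) (sum_heightGap_pos x).le
    · exact le_rfl
  · rw [heightWeight, Finsupp.onFinset_sum _ fun _ => rfl]
    rw [Finset.sum_congr rfl fun m hm => if_pos hm, ← Finset.sum_div,
      div_self (sum_heightGap_pos x).ne']

theorem heightWeight_perm_smul (σ : Equiv.Perm (Fin n)) (x : Conf (Fin n) ℂ) :
    heightWeight (σ • x) = heightWeight x := by
  ext m
  simp only [heightWeight_apply, heightGap_perm_smul]

theorem injective_height_of_heightWeight_ne_zero {x : Conf (Fin n) ℂ} {m : ℕ}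
    (h : heightWeight x m ≠ 0) : Function.Injective (height m x) := by
  rw [heightWeight_apply] at h
  refine (heightGap_ne_zero_iff m x).1 fun h0 => h ?_
  rw [h0, zero_div, ite_self]

theorem eq_sort_of_strictMono {f : Fin n → ℝ} {σ : Equiv.Perm (Fin n)} (h : StrictMono (f ∘ σ)) :
    σ = Tuple.sort f :=
  Tuple.eq_sort_iff.2 ⟨h.monotone, fun _ _ hij heq => absurd heq (h hij).ne⟩

theorem strictMono_sort {f : Fin n → ℝ} (h : Function.Injective f) :
    StrictMono (f ∘ Tuple.sort f) :=
  (Tuple.monotone_sort f).strictMono_of_injective (h.comp (Tuple.sort f).injective)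

/-- The permutations that sort a configuration by the different heights, as a map to the universal
space of the symmetric group. -/
noncomputable def sortE (x : Conf (Fin n) ℂ) : MilnorE (Equiv.Perm (Fin n)) :=
  MilnorE.ofWeights (heightWeight x) (isWeight_heightWeight x) fun m => Tuple.sort (height m x)

theorem sortE_elt (x : Conf (Fin n) ℂ) {m : ℕ} (hm : (sortE x).t m ≠ 0) :
    (sortE x).elt m = Tuple.sort (height m x) :=
  MilnorE.elt_ofWeights _ _ hm

/-- A nonzero weight means that the heights are distinct. Their strict order persists nearby, so the
sorting permutation is locally constant there. -/
theorem continuous_sortE : Continuous (sortE : Conf (Fin n) ℂ → _) := by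
  refine MilnorE.continuous_ofWeights _ (fun m => ?_) fun x m hm => ?_
  · simp only [heightWeight_apply]
    split_ifs
    · exact (continuous_heightGap m).div
        (continuous_finsetSum _ fun m _ => continuous_heightGap m) fun x =>
          (sum_heightGap_pos x).ne'
    · exact continuous_const
  · have hs := strictMono_sort (injective_height_of_heightWeight_ne_zero hm)
    refine (continuousAt_const (y := Tuple.sort (height m x))).congr ?_
    have : ∀ᶠ x' in nhds x, ∀ i j, i < j →
        height m x' (Tuple.sort (height m x) i) < height m x' (Tuple.sort (height m x) j) := by
      refine Filter.eventually_all.2 fun i => Filter.eventually_all.2 fun j => ?_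
      by_cases hij : i < j
      · filter_upwards [(continuous_height m _).continuousAt.eventually_lt
          (continuous_height m _).continuousAt (hs hij)] with x' hx' _
        exact hx'
      · exact Filter.Eventually.of_forall fun _ h => absurd h hij
    filter_upwards [this] with x' hx'
    exact eq_sort_of_strictMono fun i j hij => hx' i j hij

/-- If `τ` sorts the heights of `x`, then `σ * τ` sorts those of `σ • x`; with distinct heights the
sorting permutation is unique. -/
theorem sortE_perm_smul (σ : Equiv.Perm (Fin n)) (x : Conf (Fin n) ℂ) :
    sortE (σ • x) = σ • sortE x := by
  refine MilnorE.ext_elt (heightWeight_perm_smul σ x) fun m hm => ?_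
  have hm' : (sortE x).t m ≠ 0 := by
    have h := hm
    change heightWeight (σ • x) m ≠ 0 at h
    rwa [heightWeight_perm_smul] at h
  rw [MilnorE.elt_smul _ _ hm', sortE_elt _ hm, sortE_elt _ hm']
  refine (eq_sort_of_strictMono ?_).symm
  have := strictMono_sort (injective_height_of_heightWeight_ne_zero hm')
  intro i j hij
  simpa [height_perm_smul] using this hij

end Sorting

end Conf

/-! ### Affine maps and normalisation of configurations -/

namespace Conf

/-- The affine map `z ↦ a z + b` on configurations. -/
def affine {ι : Type} (a b : ℂ) (ha : a ≠ 0) (x : Conf ι ℂ) : Conf ι ℂ :=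
  ⟨fun i => a * x.1 i + b, fun _ _ h => x.2 (mul_left_cancel₀ ha (add_right_cancel h))⟩

theorem continuous_affine {ι : Type} (a b : ℂ) (ha : a ≠ 0) :
    Continuous (affine a b ha : Conf ι ℂ → Conf ι ℂ) :=
  continuous_of_apply fun i => (continuous_const.mul (continuous_apply i)).add continuous_const

theorem circle_smul_eq_affine {ι : Type} (w : Circle) (x : Conf ι ℂ) :
    w • x = affine w 0 (Circle.coe_ne_zero w) x :=
  Subtype.ext (funext fun i => by simp [affine, point_smul_apply, Circle.smul_def])

/-- Two configurations that differ by an affine map. -/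
def AffineEquivalent {ι : Type} (x y : Conf ι ℂ) : Prop := ∃ a b, ∃ ha : a ≠ 0, y = affine a b ha x

namespace AffineEquivalent

variable {ι : Type} {x y z : Conf ι ℂ}

theorem symm (h : AffineEquivalent x y) : AffineEquivalent y x := by
  obtain ⟨a, b, ha, rfl⟩ := h
  refine ⟨a⁻¹, -(a⁻¹ * b), inv_ne_zero ha, Subtype.ext (funext fun i => ?_)⟩
  simp only [affine]
  field_simp
  ring

theorem trans (h : AffineEquivalent x y) (h' : AffineEquivalent y z) : AffineEquivalent x z := by
  obtain ⟨a, b, ha, rfl⟩ := h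
  obtain ⟨a', b', ha', rfl⟩ := h'
  refine ⟨a' * a, a' * b + b', mul_ne_zero ha' ha, Subtype.ext (funext fun i => ?_)⟩
  simp only [affine]
  ring

theorem perm_smul (h : AffineEquivalent x y) (σ : Equiv.Perm ι) :
    AffineEquivalent (σ • x) (σ • y) := by
  obtain ⟨a, b, ha, rfl⟩ := h
  exact ⟨a, b, ha, rfl⟩

theorem circle_smul (w : Circle) (x : Conf ι ℂ) : AffineEquivalent x (w • x) :=
  ⟨w, 0, Circle.coe_ne_zero w, circle_smul_eq_affine w x⟩

end AffineEquivalent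

/-! ### Deformation onto configurations with barycentre `0` and radius `1` -/

section Normalize

variable {ι : Type} [Fintype ι]

/-- The barycentre. -/
noncomputable def mean (x : Conf ι ℂ) : ℂ := (∑ i, x.1 i) / Fintype.card ι

/-- The largest distance to the barycentre. -/
noncomputable def radius (x : Conf ι ℂ) : ℝ := ‖fun i => x.1 i - mean x‖

theorem continuous_mean : Continuous (mean : Conf ι ℂ → ℂ) :=
  (continuous_finsetSum _ fun i _ => continuous_apply i).div_const _

theorem continuous_radius : Continuous (radius : Conf ι ℂ → ℝ) :=
  (continuous_pi fun i => (continuous_apply i).sub continuous_mean).norm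

theorem mean_perm_smul (σ : Equiv.Perm ι) (x : Conf ι ℂ) : mean (σ • x) = mean x :=
  congrArg (· / _) (Fintype.sum_equiv σ⁻¹ _ _ fun _ => rfl)

theorem radius_perm_smul (σ : Equiv.Perm ι) (x : Conf ι ℂ) : radius (σ • x) = radius x := by
  unfold radius
  rw [mean_perm_smul]
  refine le_antisymm ((pi_norm_le_iff_of_nonneg (norm_nonneg _)).2 fun i => ?_)
    ((pi_norm_le_iff_of_nonneg (norm_nonneg _)).2 fun i => ?_)
  · exact norm_le_pi_norm (fun i => x.1 i - mean x) (σ⁻¹ i)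
  · have := norm_le_pi_norm (fun i => (σ • x).1 i - mean x) (σ i)
    simpa [perm_smul_apply] using this

variable [Nontrivial ι]

theorem mean_affine (a b : ℂ) (ha : a ≠ 0) (x : Conf ι ℂ) :
    mean (affine a b ha x) = a * mean x + b := by
  have : (Fintype.card ι : ℂ) ≠ 0 := Nat.cast_ne_zero.2 Fintype.card_ne_zero
  simp only [mean, affine, Finset.sum_add_distrib, ← Finset.mul_sum, Finset.sum_const,
    Finset.card_univ, nsmul_eq_mul]
  field_simp

theorem radius_affine (a b : ℂ) (ha : a ≠ 0) (x : Conf ι ℂ) :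
    radius (affine a b ha x) = ‖a‖ * radius x := by
  unfold radius
  rw [← norm_smul, mean_affine]
  congr 1
  funext i
  simp only [affine, Pi.smul_apply, smul_eq_mul]
  ring

theorem radius_pos (x : Conf ι ℂ) : 0 < radius x := by
  refine norm_pos_iff.2 fun h => ?_
  obtain ⟨i, j, hij⟩ := exists_pair_ne ι
  refine hij (x.2 ?_)
  rw [sub_eq_zero.1 (congrFun h i), sub_eq_zero.1 (congrFun h j)]

/-- The scaling factor at the time `s` of the deformation onto normalised configurations. -/
noncomputable def scale (s : unitInterval) (x : Conf ι ℂ) : ℝ :=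
  (1 - (s : ℝ)) * (radius x)⁻¹ + s

theorem scale_pos (s : unitInterval) (x : Conf ι ℂ) : 0 < scale s x := by
  have h1 := inv_pos.2 (radius_pos x)
  unfold scale
  rcases eq_or_lt_of_le s.2.2 with h | h
  · rw [h]; norm_num
  · exact add_pos_of_pos_of_nonneg (mul_pos (sub_pos.2 h) h1) s.2.1

/-- The straight-line deformation from the normalised configuration to the given one. -/
noncomputable def normalize (s : unitInterval) (x : Conf ι ℂ) : Conf ι ℂ :=
  affine (scale s x) (-(scale s x * ((1 - (s : ℝ) : ℝ) * mean x)))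
    (Complex.ofReal_ne_zero.2 (scale_pos s x).ne') x

theorem normalize_apply (s : unitInterval) (x : Conf ι ℂ) (i : ι) :
    (normalize s x).1 i = scale s x * x.1 i + -(scale s x * ((1 - (s : ℝ) : ℝ) * mean x)) := rfl

theorem affineEquivalent_normalize (s : unitInterval) (x : Conf ι ℂ) :
    AffineEquivalent x (normalize s x) := ⟨_, _, _, rfl⟩

theorem continuous_normalize :
    Continuous fun z : unitInterval × Conf ι ℂ => normalize z.1 z.2 := by
  have hs : Continuous fun z : unitInterval × Conf ι ℂ => (1 - (z.1 : ℝ) : ℝ) :=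
    continuous_const.sub (continuous_subtype_val.comp continuous_fst)
  have hr : Continuous fun z : unitInterval × Conf ι ℂ => scale z.1 z.2 :=
    (hs.mul ((continuous_radius.comp continuous_snd).inv₀ fun z => (radius_pos z.2).ne')).add
      (continuous_subtype_val.comp continuous_fst)
  have hr' := Complex.continuous_ofReal.comp hr
  refine continuous_of_apply fun i => ?_
  simp only [normalize_apply]
  exact (hr'.mul ((continuous_apply i).comp continuous_snd)).add
    (hr'.mul ((Complex.continuous_ofReal.comp hs).mul (continuous_mean.comp continuous_snd))).neg

theorem normalize_one (x : Conf ι ℂ) : normalize 1 x = x :=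
  Subtype.ext (funext fun i => by simp [normalize_apply, scale])

theorem normalize_perm_smul (s : unitInterval) (σ : Equiv.Perm ι) (x : Conf ι ℂ) :
    normalize s (σ • x) = σ • normalize s x :=
  Subtype.ext (funext fun i => by
    rw [perm_smul_apply, normalize_apply, normalize_apply, scale, scale, radius_perm_smul,
      mean_perm_smul, perm_smul_apply])

theorem normalize_circle_smul (s : unitInterval) (w : Circle) (x : Conf ι ℂ) :
    normalize s (w • x) = w • normalize s x :=
  Subtype.ext (funext fun i => by
    rw [point_smul_apply, normalize_apply, normalize_apply, scale, scale, circle_smul_eq_affine,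
      radius_affine, mean_affine, Circle.norm_coe, Circle.smul_def, smul_eq_mul]
    simp only [affine]
    ring_nf)

/-- For `z ↦ a z + b`, centring kills `b` and rescaling kills `‖a‖`; the phase `a / ‖a‖` survives.
This is how the affine group is reduced to `S¹`. -/
theorem AffineEquivalent.exists_normalize_eq {x y : Conf ι ℂ} (h : AffineEquivalent x y) :
    ∃ w : Circle, normalize 0 y = w • normalize 0 x := by
  obtain ⟨a, b, ha, rfl⟩ := h
  refine ⟨Circle.direction a ha, Subtype.ext (funext fun i => ?_)⟩
  have h1 : (‖a‖ : ℂ) ≠ 0 := by simpa using ha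
  have h2 : (radius x : ℂ) ≠ 0 := by simpa using (radius_pos x).ne'
  rw [point_smul_apply, normalize_apply, normalize_apply, scale, scale, radius_affine, mean_affine,
    Circle.smul_def, Circle.coe_direction]
  simp only [affine, Set.Icc.coe_zero, smul_eq_mul]
  push_cast
  field_simp
  ring

end Normalize

/-! ### Configurations of the plane and the moduli space -/

section Infinity

variable {ι : Type}

/-- The configuration of the sphere obtained by adding the point `∞`. -/
def addInfty (x : Conf ι ℂ) : Conf (Option ι) (OnePoint ℂ) :=
  ⟨fun i => i.elim OnePoint.infty fun i => (x.1 i : OnePoint ℂ), by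
    rintro (_ | i) (_ | j) h
    · rfl
    · exact absurd h.symm (OnePoint.coe_ne_infty _)
    · exact absurd h (OnePoint.coe_ne_infty _)
    · exact congrArg some (x.2 (OnePoint.coe_injective h))⟩

theorem continuous_addInfty : Continuous (addInfty : Conf ι ℂ → _) :=
  continuous_of_apply fun i => by
    cases i with
    | none => exact continuous_const
    | some i => exact OnePoint.continuous_coe.comp (continuous_apply i)

/-- The class of a configuration of the sphere in the moduli space. -/
noncomputable def moduliMk {κ : Type} (y : Conf κ (OnePoint ℂ)) : ModuliZero κ := Quotient.mk _ y

theorem continuous_moduliMk {κ : Type} : Continuous (moduliMk : Conf κ (OnePoint ℂ) → _) :=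
  continuous_quotient_mk'

/-- The class of a configuration of the plane in the moduli space. -/
noncomputable def toModuli (x : Conf ι ℂ) : ModuliZero (Option ι) := moduliMk (addInfty x)

theorem continuous_toModuli : Continuous (toModuli : Conf ι ℂ → _) :=
  continuous_moduliMk.comp continuous_addInfty

theorem moduliMk_eq_iff {κ : Type} {y y' : Conf κ (OnePoint ℂ)} :
    moduliMk y = moduliMk y' ↔ ∃ g : GL (Fin 2) ℂ, g • y = y' := by
  rw [eq_comm, moduliMk, moduliMk]
  exact Quotient.eq

/-- The stabiliser of `∞` in `GL₂(ℂ)` consists of the upper triangular matrices, which act on `ℂ` as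
the affine maps. -/
theorem toModuli_eq_iff {x y : Conf ι ℂ} : toModuli x = toModuli y ↔ AffineEquivalent x y := by
  rw [toModuli, toModuli, moduliMk_eq_iff]
  constructor
  · rintro ⟨g, hg⟩
    have h : ∀ i, g • (addInfty x).1 i = (addInfty y).1 i := fun i =>
      congrFun (congrArg Subtype.val hg) i
    have h10 : g 1 0 = 0 := OnePoint.smul_infty_eq_self_iff.1 (h none)
    have hdet := g.det_ne_zero
    rw [Matrix.det_fin_two, h10, mul_zero, sub_zero] at hdet
    have h00 := left_ne_zero_of_mul hdet
    have h11 := right_ne_zero_of_mul hdet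
    refine ⟨g 0 0 / g 1 1, g 0 1 / g 1 1, div_ne_zero h00 h11, Subtype.ext (funext fun i => ?_)⟩
    have hi : g • (x.1 i : OnePoint ℂ) = y.1 i := h (some i)
    simp only [OnePoint.smul_some_eq_ite, h10, zero_mul, zero_add, h11, if_false] at hi
    rw [← OnePoint.coe_injective hi]
    simp only [affine]
    ring
  · rintro ⟨a, b, ha, rfl⟩
    refine ⟨Matrix.GeneralLinearGroup.mkOfDetNeZero !![a, b; 0, 1] (by simpa using ha),
      Subtype.ext (funext fun i => ?_)⟩
    rw [point_smul_apply]
    cases i with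
    | none => exact OnePoint.smul_infty_eq_self_iff.2 rfl
    | some i =>
      simp [addInfty, OnePoint.smul_some_eq_ite, Matrix.GeneralLinearGroup.mkOfDetNeZero, affine]

/-- The Möbius transformation `z ↦ (z - c)⁻¹`. -/
noncomputable def invSub (c : ℂ) : GL (Fin 2) ℂ :=
  Matrix.GeneralLinearGroup.mkOfDetNeZero !![0, 1; 1, -c] (by simp)

theorem invSub_smul_infty (c : ℂ) :
    invSub c • (OnePoint.infty : OnePoint ℂ) = ((0 : ℂ) : OnePoint ℂ) := by
  simp [OnePoint.smul_infty_eq_ite, invSub, Matrix.GeneralLinearGroup.mkOfDetNeZero]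

theorem invSub_smul_self (c : ℂ) : invSub c • (c : OnePoint ℂ) = OnePoint.infty := by
  simp [OnePoint.smul_some_eq_ite, invSub, Matrix.GeneralLinearGroup.mkOfDetNeZero]

theorem invSub_smul_coe {c z : ℂ} (h : z ≠ c) :
    invSub c • (z : OnePoint ℂ) = ((z - c)⁻¹ : ℂ) := by
  have : z + -c ≠ 0 := by rwa [← sub_eq_add_neg, _root_.sub_ne_zero]
  simp [OnePoint.smul_some_eq_ite, invSub, Matrix.GeneralLinearGroup.mkOfDetNeZero, this,
    sub_eq_add_neg]

/-- The function `z ↦ (z - c)⁻¹` on the sphere without `c`. -/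
noncomputable def invSubFun (c : ℂ) (z : OnePoint ℂ) : ℂ := z.elim 0 fun z => (z - c)⁻¹

theorem coe_invSubFun {c : ℂ} {z : OnePoint ℂ} (h : z ≠ c) :
    (invSubFun c z : OnePoint ℂ) = invSub c • z := by
  induction z using OnePoint.rec with
  | infty => exact (invSub_smul_infty c).symm
  | coe z => exact (invSub_smul_coe fun hz => h (congrArg _ hz)).symm

theorem continuousAt_invSubFun {c : ℂ} {z : OnePoint ℂ} (h : z ≠ c) :
    ContinuousAt (invSubFun c) z := by
  induction z using OnePoint.rec with
  | infty =>
    rw [OnePoint.continuousAt_infty']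
    have h1 : Filter.Tendsto (fun z : ℂ => (z - c)⁻¹) (Bornology.cobounded ℂ) (nhds 0) :=
      Filter.tendsto_inv₀_cobounded.comp (tendsto_sub_const_cobounded c)
    rwa [Metric.cobounded_eq_cocompact, ← Filter.coclosedCompact_eq_cocompact] at h1
  | coe z =>
    rw [OnePoint.continuousAt_coe]
    exact (continuousAt_id.sub continuousAt_const).inv₀
      (_root_.sub_ne_zero.2 fun hz => h (congrArg _ hz))

/-- A representative in the plane of a configuration of the sphere that avoids `c`. -/
noncomputable def planeLift (c : ℂ)
    (y : {y : Conf (Option ι) (OnePoint ℂ) // ∀ i, y.1 i ≠ c}) : Conf ι ℂ :=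
  ⟨fun i => (invSubFun c (y.1.1 (some i)) - invSubFun c (y.1.1 none))⁻¹, fun i j h => by
    have h' : (invSubFun c (y.1.1 (some i)) : OnePoint ℂ) = invSubFun c (y.1.1 (some j)) :=
      congrArg _ (sub_left_injective (inv_injective h))
    rw [coe_invSubFun (y.2 _), coe_invSubFun (y.2 _)] at h'
    exact Option.some_injective _ (y.1.2 (MulAction.injective _ h'))⟩

theorem invSubFun_ne {c : ℂ} {y : Conf (Option ι) (OnePoint ℂ)} (hy : ∀ i, y.1 i ≠ c) (i : ι) :
    invSubFun c (y.1 (some i)) ≠ invSubFun c (y.1 none) := fun h => by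
  have h' : (invSubFun c (y.1 (some i)) : OnePoint ℂ) = invSubFun c (y.1 none) := congrArg _ h
  rw [coe_invSubFun (hy _), coe_invSubFun (hy _)] at h'
  exact Option.some_ne_none _ (y.2 (MulAction.injective _ h'))

/-- The first inversion sends the avoided point `c` to `∞`, so all marked points become finite; the
second sends the extra marked point to `∞`. The detour through `c` keeps the formula continuous even
where a marked point passes through `∞`. -/
theorem toModuli_planeLift (c : ℂ)
    (y : {y : Conf (Option ι) (OnePoint ℂ) // ∀ i, y.1 i ≠ c}) :
    toModuli (planeLift c y) = moduliMk y.1 := by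
  refine (moduliMk_eq_iff.2
    ⟨invSub (invSubFun c (y.1.1 none)) * invSub c, Subtype.ext (funext fun i => ?_)⟩).symm
  rw [point_smul_apply, mul_smul, ← coe_invSubFun (y.2 i)]
  cases i with
  | none => exact invSub_smul_self _
  | some i => exact invSub_smul_coe (invSubFun_ne y.2 i)

theorem continuous_planeLift (c : ℂ) : Continuous (planeLift (ι := ι) c) := by
  have h : ∀ k, Continuous fun y : {y : Conf (Option ι) (OnePoint ℂ) // ∀ i, y.1 i ≠ c} =>
      invSubFun c (y.1.1 k) := fun k => continuous_iff_continuousAt.2 fun y =>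
    ContinuousAt.comp (f := fun y : {y : Conf (Option ι) (OnePoint ℂ) // ∀ i, y.1 i ≠ c} =>
      y.1.1 k) (continuousAt_invSubFun (y.2 k))
      ((continuous_apply k).comp continuous_subtype_val).continuousAt
  exact continuous_of_apply fun i => ((h (some i)).sub (h none)).inv₀ fun y =>
    _root_.sub_ne_zero.2 (invSubFun_ne y.2 i)

variable [Finite ι]

theorem exists_forall_ne_coe (y : Conf (Option ι) (OnePoint ℂ)) : ∃ c : ℂ, ∀ i, y.1 i ≠ c := by
  have hfin : ((fun c : ℂ => (c : OnePoint ℂ)) ⁻¹' Set.range y.1).Finite :=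
    (Set.finite_range y.1).preimage OnePoint.coe_injective.injOn
  obtain ⟨c, hc⟩ := hfin.exists_notMem
  exact ⟨c, fun i hi => hc ⟨i, hi⟩⟩

/-- Configurations of the sphere avoiding a given `c` form an open set on which `planeLift c` is a
continuous lift, and every finite configuration avoids some `c`. -/
theorem isOpenQuotientMap_toModuli : IsOpenQuotientMap (toModuli : Conf ι ℂ → _) where
  surjective m := by
    induction m using Quotient.inductionOn with
    | h y =>
      obtain ⟨c, hc⟩ := exists_forall_ne_coe y
      exact ⟨_, toModuli_planeLift c ⟨y, hc⟩⟩
  continuous := continuous_toModuli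
  isOpenMap V hV := by
    refine isOpen_coinduced.2 (isOpen_iff_mem_nhds.2 ?_)
    rintro y ⟨x, hx, hxy⟩
    obtain ⟨c, hc⟩ := exists_forall_ne_coe y
    have hU : IsOpen {y : Conf (Option ι) (OnePoint ℂ) | ∀ i, y.1 i ≠ c} := by
      simp only [Set.ofPred_forall]
      exact isOpen_iInter_of_finite fun i => isOpen_ne.preimage (continuous_apply i)
    -- The lift of `y` need not lie in `V`; a fixed affine map takes it to `x ∈ V`, and the
    -- corrected lift stays in `V` near `y`.
    obtain ⟨a, b, ha, hab⟩ : AffineEquivalent (planeLift c ⟨y, hc⟩) x :=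
      toModuli_eq_iff.1 ((toModuli_planeLift c ⟨y, hc⟩).trans hxy.symm)
    have hO := hU.isOpenMap_subtype_val _
      (hV.preimage ((continuous_affine a b ha).comp (continuous_planeLift c)))
    refine Filter.mem_of_superset (hO.mem_nhds ⟨⟨y, hc⟩, ?_, rfl⟩) ?_
    · rwa [Set.mem_preimage, Function.comp_apply, ← hab]
    · rintro _ ⟨y', hy', rfl⟩
      refine ⟨_, hy', ?_⟩
      exact (toModuli_eq_iff.2 (AffineEquivalent.symm ⟨a, b, ha, rfl⟩)).trans
        (toModuli_planeLift c y')

end Infinity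

end Conf

/-! ### Homotopy equivalences of quotients -/

section Quotients

variable {T T' W W' : Type} [TopologicalSpace T] [TopologicalSpace T'] [TopologicalSpace W]
  [TopologicalSpace W']

/-- Openness makes `id × p` on `[0,1] × T` a quotient map again, so the homotopy factors through it.
-/
theorem IsOpenQuotientMap.exists_homotopy_id {p : T → W} (hp : IsOpenQuotientMap p)
    {k : C(T, T)} (H : k.Homotopy (ContinuousMap.id T))
    (hH : ∀ t x y, p x = p y → p (H (t, x)) = p (H (t, y))) {l : C(W, W)}
    (hl : ∀ x, l (p x) = p (k x)) : l.Homotopic (ContinuousMap.id W) := by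
  let q : C(unitInterval × T, unitInterval × W) :=
    (ContinuousMap.id unitInterval).prodMap ⟨p, hp.continuous⟩
  have hq : Topology.IsQuotientMap q := (IsOpenQuotientMap.id.prodMap hp).isQuotientMap
  let P : C(unitInterval × T, W) := ⟨fun z => p (H z), hp.continuous.comp H.continuous⟩
  have hP : Function.FactorsThrough P q := by
    rintro ⟨s, x⟩ ⟨t, y⟩ h
    obtain ⟨rfl, h'⟩ := Prod.ext_iff.1 h
    exact hH _ _ _ h'
  have key : ∀ t x, hq.lift P hP (t, p x) = p (H (t, x)) := fun t x =>
    DFunLike.congr_fun (hq.lift_comp P hP) (t, x)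
  refine ⟨⟨hq.lift P hP, fun w => ?_, fun w => ?_⟩⟩
  · obtain ⟨x, rfl⟩ := hp.surjective w
    exact (key 0 x).trans (by rw [H.apply_zero, hl])
  · obtain ⟨x, rfl⟩ := hp.surjective w
    exact (key 1 x).trans (by rw [H.apply_one]; rfl)

/-- A homotopy equivalence compatible with two open quotient maps descends to the quotients. -/
theorem nonempty_homotopyEquiv_of_isOpenQuotientMap {p : T → W} (hp : IsOpenQuotientMap p)
    {p' : T' → W'} (hp' : IsOpenQuotientMap p') (f : C(T, T')) (g : C(T', T))
    (hf : ∀ x y, p x = p y → p' (f x) = p' (f y)) (hg : ∀ x y, p' x = p' y → p (g x) = p (g y))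
    (H : (g.comp f).Homotopy (ContinuousMap.id T))
    (hH : ∀ t x y, p x = p y → p (H (t, x)) = p (H (t, y)))
    (H' : (f.comp g).Homotopy (ContinuousMap.id T'))
    (hH' : ∀ t x y, p' x = p' y → p' (H' (t, x)) = p' (H' (t, y))) : Nonempty (W ≃ₕ W') := by
  let q : C(T, W) := ⟨p, hp.continuous⟩
  let q' : C(T', W') := ⟨p', hp'.continuous⟩
  have hq : Topology.IsQuotientMap q := hp.isQuotientMap
  have hq' : Topology.IsQuotientMap q' := hp'.isQuotientMap
  let P : C(T, W') := ⟨fun x => p' (f x), hp'.continuous.comp f.continuous⟩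
  let P' : C(T', W) := ⟨fun x => p (g x), hp.continuous.comp g.continuous⟩
  have hP : Function.FactorsThrough P q := fun x y h => hf x y h
  have hP' : Function.FactorsThrough P' q' := fun x y h => hg x y h
  have key : ∀ x, hq.lift P hP (p x) = p' (f x) :=
    DFunLike.congr_fun (hq.lift_comp P hP)
  have key' : ∀ x, hq'.lift P' hP' (p' x) = p (g x) :=
    DFunLike.congr_fun (hq'.lift_comp P' hP')
  refine ⟨⟨hq.lift P hP, hq'.lift P' hP',
    hp.exists_homotopy_id H hH fun x => ?_, hp'.exists_homotopy_id H' hH' fun x => ?_⟩⟩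
  · rw [ContinuousMap.comp_apply, key, key', ContinuousMap.comp_apply]
  · rw [ContinuousMap.comp_apply, key', key, ContinuousMap.comp_apply]

end Quotients

/-! ### Homotopy quotients of quotients -/

namespace HomotopyQuotient

variable {G X Q : Type} [Group G] [TopologicalSpace G] [TopologicalSpace Q]
  [MulAction G Q]

/-- The map `EG × X → EG × Q → Q_G` for a map `X → Q`. -/
def mkMap (q : X → Q) (z : MilnorE G × X) : HomotopyQuotient G Q := Quotient.mk _ (z.1, q z.2)

theorem mkMap_eq_iff {q : X → Q} {z z' : MilnorE G × X} :
    mkMap q z = mkMap q z' ↔ ∃ g : G, g • z.1 = z'.1 ∧ g • q z.2 = q z'.2 := by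
  rw [eq_comm, mkMap, mkMap]
  refine Quotient.eq.trans (exists_congr fun g => ?_)
  exact Prod.ext_iff

/-- Openness of `q` is essential: the product of `EG` with a mere quotient map need not be a
quotient map. -/
theorem isOpenQuotientMap_mkMap [IsTopologicalGroup G] [ContinuousConstSMul G Q]
    [TopologicalSpace X] {q : X → Q} (hq : IsOpenQuotientMap q) :
    IsOpenQuotientMap (mkMap (G := G) q) := by
  have h : IsOpenQuotientMap
      (Quotient.mk (MulAction.orbitRel G (MilnorE G × Q))) := MulAction.isOpenQuotientMap_quotientMk
  exact h.comp (IsOpenQuotientMap.id.prodMap hq)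

end HomotopyQuotient

theorem IsOpenQuotientMap.continuousConstSMul {G X Q : Type} [TopologicalSpace X]
    [TopologicalSpace Q] [SMul G X] [SMul G Q] [ContinuousConstSMul G X] {q : X → Q}
    (hq : IsOpenQuotientMap q) (hG : ∀ (g : G) x, q (g • x) = g • q x) :
    ContinuousConstSMul G Q where
  continuous_const_smul g := by
    refine hq.continuous_comp_iff.1 ?_
    refine (hq.continuous.comp (continuous_const_smul g)).congr fun x => ?_
    exact hG g x

/-! ### Both homotopy quotients as quotients of a universal space times `F_n(ℂ)` -/

namespace Conf

variable {n : ℕ}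

/-- The class of a configuration of the plane in `M_{0,n+1}`. -/
noncomputable def toModuliSucc (x : Conf (Fin n) ℂ) : ModuliZeroSucc n := toModuli x

theorem isOpenQuotientMap_toModuliSucc :
    IsOpenQuotientMap (toModuliSucc : Conf (Fin n) ℂ → ModuliZeroSucc n) :=
  isOpenQuotientMap_toModuli

theorem toModuliSucc_eq_iff {x y : Conf (Fin n) ℂ} :
    toModuliSucc x = toModuliSucc y ↔ AffineEquivalent x y :=
  toModuli_eq_iff

theorem permSucc_smul_addInfty (σ : Equiv.Perm (Fin n)) (x : Conf (Fin n) ℂ) :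
    permSucc n σ • addInfty x = addInfty (σ • x) :=
  Subtype.ext (funext fun i => by
    cases i with
    | none => rfl
    | some i => rfl)

theorem toModuliSucc_perm_smul (σ : Equiv.Perm (Fin n)) (x : Conf (Fin n) ℂ) :
    toModuliSucc (σ • x) = σ • toModuliSucc x :=
  congrArg moduliMk (permSucc_smul_addInfty σ x).symm

instance : ContinuousConstSMul (Equiv.Perm (Fin n)) (ModuliZeroSucc n) :=
  isOpenQuotientMap_toModuliSucc.continuousConstSMul toModuliSucc_perm_smul

/-- The underlying unordered configuration. -/
def toUnordered (x : Conf (Fin n) ℂ) : UnorderedConf n := Quotient.mk _ x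

theorem isOpenQuotientMap_toUnordered :
    IsOpenQuotientMap (toUnordered : Conf (Fin n) ℂ → UnorderedConf n) :=
  MulAction.isOpenQuotientMap_quotientMk

theorem toUnordered_eq_iff {x y : Conf (Fin n) ℂ} :
    toUnordered x = toUnordered y ↔ ∃ σ : Equiv.Perm (Fin n), σ • x = y := by
  rw [eq_comm, toUnordered, toUnordered]
  exact Quotient.eq

theorem toUnordered_circle_smul (w : Circle) (x : Conf (Fin n) ℂ) :
    toUnordered (w • x) = w • toUnordered x := rfl

instance : ContinuousConstSMul Circle (UnorderedConf n) :=
  isOpenQuotientMap_toUnordered.continuousConstSMul toUnordered_circle_smul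

/-- The projection `EΣ_n × F_n(ℂ) → (M_{0,n+1})_{Σ_n}`. -/
noncomputable def toModuliQuotient :
    MilnorE (Equiv.Perm (Fin n)) × Conf (Fin n) ℂ →
      HomotopyQuotient (Equiv.Perm (Fin n)) (ModuliZeroSucc n) :=
  HomotopyQuotient.mkMap toModuliSucc

theorem toModuliQuotient_eq_iff {z z' : MilnorE (Equiv.Perm (Fin n)) × Conf (Fin n) ℂ} :
    toModuliQuotient z = toModuliQuotient z' ↔
      ∃ σ : Equiv.Perm (Fin n), σ • z.1 = z'.1 ∧ AffineEquivalent (σ • z.2) z'.2 := by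
  refine HomotopyQuotient.mkMap_eq_iff.trans (exists_congr fun σ => and_congr_right fun _ => ?_)
  rw [← toModuliSucc_perm_smul, toModuliSucc_eq_iff]

/-- The projection `ES¹ × F_n(ℂ) → C_n(ℂ)_{S¹}`. -/
noncomputable def toUnorderedQuotient :
    MilnorE Circle × Conf (Fin n) ℂ → HomotopyQuotient Circle (UnorderedConf n) :=
  HomotopyQuotient.mkMap toUnordered

theorem toUnorderedQuotient_eq_iff {z z' : MilnorE Circle × Conf (Fin n) ℂ} :
    toUnorderedQuotient z = toUnorderedQuotient z' ↔
      ∃ w : Circle, w • z.1 = z'.1 ∧ ∃ σ : Equiv.Perm (Fin n), σ • w • z.2 = z'.2 := by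
  refine HomotopyQuotient.mkMap_eq_iff.trans (exists_congr fun w => and_congr_right fun _ => ?_)
  rw [← toUnordered_circle_smul, toUnordered_eq_iff]

/-! ### The two comparison maps -/

/-- The map `EΣ_n × F_n(ℂ) → ES¹`. -/
noncomputable def toCircleE {i j : Fin n} (h : i ≠ j) (e : MilnorE (Equiv.Perm (Fin n)))
    (x : Conf (Fin n) ℂ) : MilnorE Circle :=
  MilnorE.average (directionE h) e x

/-- The map `ES¹ × F_n(ℂ) → EΣ_n`. -/
noncomputable def toPermE (a : MilnorE Circle) (x : Conf (Fin n) ℂ) :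
    MilnorE (Equiv.Perm (Fin n)) :=
  MilnorE.average sortE a x

/-- A relabelling changes which two points define the direction; averaging over `EΣ_n` absorbs this,
while rotations, which commute with relabelling, pass through. -/
theorem toCircleE_smul {i j : Fin n} (h : i ≠ j) (σ : Equiv.Perm (Fin n)) (w : Circle)
    (e : MilnorE (Equiv.Perm (Fin n))) (x : Conf (Fin n) ℂ) :
    toCircleE h (σ • e) (σ • w • x) = w • toCircleE h e x := by
  rw [toCircleE, MilnorE.average_smul_smul]
  exact MilnorE.average_smul_right
    (fun τ => by rw [perm_smul_point_smul, directionE_smul]) e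

/-- The mirror image: heights are not rotation invariant, and averaging over `ES¹` repairs this. -/
theorem toPermE_smul (σ : Equiv.Perm (Fin n)) (w : Circle) (a : MilnorE Circle)
    (x : Conf (Fin n) ℂ) : toPermE (w • a) (σ • w • x) = σ • toPermE a x := by
  rw [toPermE, perm_smul_point_smul, MilnorE.average_smul_smul]
  exact MilnorE.average_smul_right
    (fun v => by rw [← perm_smul_point_smul, sortE_perm_smul]) a

theorem continuous_toCircleE {i j : Fin n} (h : i ≠ j) {Z : Type} [TopologicalSpace Z]
    {e : Z → MilnorE (Equiv.Perm (Fin n))} {x : Z → Conf (Fin n) ℂ} (he : Continuous e)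
    (hx : Continuous x) : Continuous fun z => toCircleE h (e z) (x z) := by
  have hc := (MilnorE.continuous_average (H := Equiv.Perm (Fin n)) (continuous_directionE h)).comp
    (he.prodMk hx)
  exact hc

theorem continuous_toPermE {Z : Type} [TopologicalSpace Z]
    {a : Z → MilnorE Circle} {x : Z → Conf (Fin n) ℂ} (ha : Continuous a)
    (hx : Continuous x) : Continuous fun z => toPermE (a z) (x z) := by
  have hc := (MilnorE.continuous_average (H := Circle) (continuous_sortE (n := n))).comp
    (ha.prodMk hx)
  exact hc

end Conf

/-- For fixed `b` this contracts `EG` to `b`; letting `b` vary makes it equivariant. It will join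
the universal coordinate of a round trip to the original one. -/
theorem MilnorE.exists_contraction (G : Type) [Group G] [TopologicalSpace G] :
    ∃ K : unitInterval → MilnorE G → MilnorE G → MilnorE G,
      (Continuous fun z : unitInterval × MilnorE G × MilnorE G => K z.1 z.2.1 z.2.2) ∧
      (∀ a b, K 0 a b = a) ∧ (∀ a b, K 1 a b = b) ∧
      ∀ t (g : G) a b, K t (g • a) (g • b) = g • K t a b := by
  obtain ⟨H⟩ := MilnorE.equivariantHomotopic_fst_snd G
  exact ⟨fun t a b => H (t, (a, b)), H.continuous, fun a b => H.apply_zero (a, b),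
    fun a b => H.apply_one (a, b), fun t g a b => H.prop t g a b⟩

/-! ### Assembling the homotopy equivalence -/

open Conf in
/-- The homotopy quotients `(M_{0,n+1})_{Σ_n}` and `C_n(ℂ)_{S¹}` are homotopy equivalent. -/
theorem nonempty_homotopyEquiv_moduli_unordered (n : ℕ) (hn : 2 ≤ n) :
    Nonempty (HomotopyQuotient (Equiv.Perm (Fin n)) (ModuliZeroSucc n) ≃ₕ
      HomotopyQuotient Circle (UnorderedConf n)) := by
  have : Nontrivial (Fin n) := Fin.nontrivial_iff_two_le.2 hn
  obtain ⟨i, j, hij⟩ := exists_pair_ne (Fin n)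
  obtain ⟨K, hK, hK0, hK1, hKG⟩ := MilnorE.exists_contraction (Equiv.Perm (Fin n))
  obtain ⟨L, hL, hL0, hL1, hLG⟩ := MilnorE.exists_contraction Circle
  have cν : Continuous fun x : Conf (Fin n) ℂ => normalize 0 x :=
    continuous_normalize.comp (continuous_const.prodMk continuous_id)
  -- Representatives on the moduli side agree only up to affine maps, while the target allows only
  -- rotations and relabellings; hence the normalisation. The map `g` needs none, because rotations
  -- are affine.
  let f : C(MilnorE (Equiv.Perm (Fin n)) × Conf (Fin n) ℂ, MilnorE Circle × Conf (Fin n) ℂ) :=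
    ⟨fun z => (toCircleE hij z.1 (normalize 0 z.2), normalize 0 z.2),
      (continuous_toCircleE hij continuous_fst (cν.comp continuous_snd)).prodMk
        (cν.comp continuous_snd)⟩
  let g : C(MilnorE Circle × Conf (Fin n) ℂ, MilnorE (Equiv.Perm (Fin n)) × Conf (Fin n) ℂ) :=
    ⟨fun z => (toPermE z.1 z.2, z.2),
      (continuous_toPermE continuous_fst continuous_snd).prodMk continuous_snd⟩
  have hν : ∀ (σ : Equiv.Perm (Fin n)) (x y : Conf (Fin n) ℂ), AffineEquivalent (σ • x) y →
      ∃ w : Circle, normalize 0 y = σ • w • normalize 0 x := fun σ x y h => by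
    obtain ⟨w, hw⟩ := h.exists_normalize_eq
    exact ⟨w, by rw [hw, normalize_perm_smul, perm_smul_point_smul]⟩
  let H : (g.comp f).Homotopy (ContinuousMap.id _) :=
    { toFun := fun z => (K z.1 (toPermE (toCircleE hij z.2.1 (normalize 0 z.2.2))
        (normalize 0 z.2.2)) z.2.1, normalize z.1 z.2.2)
      continuous_toFun := by
        have c1 := (continuous_fst.comp (g.comp f).continuous).comp
          (continuous_snd (X := unitInterval))
        have c2 := hK.comp (continuous_fst.prodMk (c1.prodMk
          (continuous_fst.comp continuous_snd)))
        have c3 := (continuous_normalize (ι := Fin n)).comp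
          (continuous_fst.prodMk ((continuous_snd
            (X := MilnorE (Equiv.Perm (Fin n)))).comp continuous_snd))
        exact c2.prodMk c3
      map_zero_left := fun z => Prod.ext (hK0 _ _) rfl
      map_one_left := fun z => Prod.ext (hK1 _ _) (normalize_one _) }
  let H' : (f.comp g).Homotopy (ContinuousMap.id _) :=
    { toFun := fun z => (L z.1 (toCircleE hij (toPermE z.2.1 z.2.2) (normalize 0 z.2.2)) z.2.1,
        normalize z.1 z.2.2)
      continuous_toFun := by
        have c1 := (continuous_fst.comp (f.comp g).continuous).comp
          (continuous_snd (X := unitInterval))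
        have c2 := hL.comp (continuous_fst.prodMk (c1.prodMk
          (continuous_fst.comp continuous_snd)))
        have c3 := (continuous_normalize (ι := Fin n)).comp
          (continuous_fst.prodMk ((continuous_snd
            (X := MilnorE Circle)).comp continuous_snd))
        exact c2.prodMk c3
      map_zero_left := fun z => Prod.ext (hL0 _ _) rfl
      map_one_left := fun z => Prod.ext (hL1 _ _) (normalize_one _) }
  refine nonempty_homotopyEquiv_of_isOpenQuotientMap (p := toModuliQuotient (n := n))
    (p' := toUnorderedQuotient (n := n))
    (HomotopyQuotient.isOpenQuotientMap_mkMap isOpenQuotientMap_toModuliSucc)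
    (HomotopyQuotient.isOpenQuotientMap_mkMap isOpenQuotientMap_toUnordered) f g ?_ ?_ H ?_ H' ?_
  · rintro ⟨e, x⟩ ⟨e', x'⟩ h
    obtain ⟨σ, rfl, hx⟩ := toModuliQuotient_eq_iff.1 h
    obtain ⟨w, hw⟩ := hν σ x x' hx
    refine toUnorderedQuotient_eq_iff.2 ⟨w, ?_, σ, hw.symm⟩
    change _ = toCircleE hij (σ • e) (normalize 0 x')
    rw [hw, toCircleE_smul]
    rfl
  · rintro ⟨a, x⟩ ⟨a', x'⟩ h
    obtain ⟨w, rfl, σ, rfl⟩ := toUnorderedQuotient_eq_iff.1 h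
    exact toModuliQuotient_eq_iff.2 ⟨σ, (toPermE_smul σ w a x).symm,
      (AffineEquivalent.circle_smul w x).perm_smul σ⟩
  · rintro t ⟨e, x⟩ ⟨e', x'⟩ h
    obtain ⟨σ, rfl, hx⟩ := toModuliQuotient_eq_iff.1 h
    obtain ⟨w, hw⟩ := hν σ x x' hx
    refine toModuliQuotient_eq_iff.2 ⟨σ, ?_, ?_⟩
    · change σ • K t _ e = K t (toPermE (toCircleE hij (σ • e) (normalize 0 x'))
        (normalize 0 x')) (σ • e)
      rw [hw, toCircleE_smul, toPermE_smul, hKG]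
    -- The straight-line path stays within one affine class, so on the moduli side the second
    -- coordinate does not move at all.
    · exact (((affineEquivalent_normalize t x).perm_smul σ).symm.trans hx).trans
        (affineEquivalent_normalize t x')
  · rintro t ⟨a, x⟩ ⟨a', x'⟩ h
    obtain ⟨w, rfl, σ, rfl⟩ := toUnorderedQuotient_eq_iff.1 h
    refine toUnorderedQuotient_eq_iff.2 ⟨w, ?_, σ, ?_⟩
    · change w • L t _ a = L t (toCircleE hij (toPermE (w • a) (σ • w • x))
        (normalize 0 (σ • w • x))) (w • a)
      -- Here `σ` acts on the permutation coordinate and `w` on the configuration, so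
      -- `toCircleE_smul` turns the pair into the single factor `w`.
      rw [toPermE_smul, normalize_perm_smul, normalize_circle_smul, toCircleE_smul, hLG]
    · change σ • w • normalize t x = normalize t (σ • w • x)
      rw [normalize_perm_smul, normalize_circle_smul]

/-! ### Homotopy invariance of homology -/

theorem singularHomology_map_eq_of_homotopic (R : Type u) [CommRing R] (A : ModuleCat.{u} R)
    (k : ℕ) {X Y : TopCat.{0}} {f g : X ⟶ Y} (h : f.hom.Homotopic g.hom) :
    (singularHomology R A k).map f = (singularHomology R A k).map g := by
  obtain ⟨H⟩ := h
  exact TopCat.Homotopy.congr_homologyMap_singularChainComplexFunctor H A k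

/-- The isomorphism on homology induced by a homotopy equivalence. -/
noncomputable def singularHomologyIso (R : Type u) [CommRing R] (A : ModuleCat.{u} R) (k : ℕ)
    {X Y : Type} [TopologicalSpace X] [TopologicalSpace Y] (e : X ≃ₕ Y) :
    (singularHomology R A k).obj (TopCat.of X) ≅ (singularHomology R A k).obj (TopCat.of Y) where
  hom := (singularHomology R A k).map (TopCat.ofHom e.toFun)
  inv := (singularHomology R A k).map (TopCat.ofHom e.invFun)
  hom_inv_id := by
    rw [← CategoryTheory.Functor.map_comp, ← CategoryTheory.Functor.map_id]
    exact singularHomology_map_eq_of_homotopic R A k e.left_inv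
  inv_hom_id := by
    rw [← CategoryTheory.Functor.map_comp, ← CategoryTheory.Functor.map_id]
    exact singularHomology_map_eq_of_homotopic R A k e.right_inv

theorem mainTheorem9 (n : ℕ) (hn : 2 ≤ n) :
    ∃ e : HomotopyQuotient (Equiv.Perm (Fin n)) (ModuliZeroSucc n) ≃ₕ
        HomotopyQuotient Circle (UnorderedConf n),
      ∀ (R : Type u) [CommRing R] (A : ModuleCat.{u} R) (k : ℕ),
        ∃ φ : equivariantHomology (Equiv.Perm (Fin n)) (ModuliZeroSucc n) R A k ≅
            equivariantHomology Circle (UnorderedConf n) R A k,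
          φ.hom = (singularHomology R A k).map (TopCat.ofHom e.toFun) := by
  obtain ⟨e⟩ := nonempty_homotopyEquiv_moduli_unordered n hn
  exact ⟨e, fun R _ A k => ⟨singularHomologyIso R A k e, rfl⟩⟩
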